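/- Let $\Pi_\ell=\{x_i\}$ (legitimate nodes) and $\Pi_{\mathrm e}=\{e_k\}$ (eavesdroppers) be independent homogeneous Poisson point processes on $\mathbb R^2$ with densities $\lambda_\ell>0$ and $\lambda_{\mathrm e}>0$. Add a legitimate node $0$ at the origin; this is the typical node (Slivnyak). To every unordered pair of distinct nodes $\{u,v\}$ is attached a random propagation effect $Z_{u,v}=Z_{v,u}$; these variables are i.i.d. with common law $\nu$ and independent of $(\Pi_\ell,\Pi_{\mathrm e})$. Here $\nu$ is an arbitrary probability law on $\mathbb R$, for instance one with a continuous density $f_Z$. The received power over the link $uv$ is $P_{\mathrm{rx}}(u,v)=P\,g(|u-v|,Z_{u,v})$, where $P>0$ and $g$ is a measurable gain function such that, for $\nu$-almost every $z$, the function $r\mapsto g(r,z)$ is continuous and strictly decreasing on $(0,\infty)$ with $\lim_{r\to\infty}g(r,z)=0$. Assume that almost surely some eavesdropper has maximal received power from the node $0$, i.e. $e^*=\operatorname{argmax}_{e_k}P_{\mathrm{rx}}(0,e_k)$ exists. With secrecy-rate threshold $0$ and equal noise powers $\sigma^2>0$, the $i\mathcal S$-graph on $\Pi_\ell\cup\{0\}$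 has an edge from $x$ to $y\ne x$ if and only if the eavesdropper $e^*=\operatorname{argmax}_{e_k}P_{\mathrm{rx}}(x,e_k)$ exists and $$\left[\log_2\!\Big(1+\tfrac{P_{\mathrm{rx}}(x,y)}{\sigma^2}\Big)-\log_2\!\Big(1+\tfrac{P_{\mathrm{rx}}(x,e^*)}{\sigma^2}\Big)\right]^+>0 .$$ Then the out-degree $N_{\mathrm{out}}$ and the in-degree $N_{\mathrm{in}}$ of the node $0$ are random variables, $$\mathbb P\{N_{\mathrm{out}}=n\}=\left(\frac{\lambda_\ell}{\lambda_\ell+\lambda_{\mathrm e}}\right)^{n}\frac{\lambda_{\mathrm e}}{\lambda_\ell+\lambda_{\mathrm e}},\qquad n\ge 0,$$ so the law of $N_{\mathrm{out}}$ is the same for every such $\nu$ (in particular invariant with respect to $f_Z$), and $$\mathbb E\{N_{\mathrm{in}}\}=\mathbb E\{N_{\mathrm{out}}\}=\frac{\lambda_\ell}{\lambda_{\mathrm e}} .$$ -/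

import Mathlib

open MeasureTheory ProbabilityTheory Set Filter Topology
open scoped NNReal ENNReal

namespace SecrecyGraph

/-- The plane with its Euclidean norm. -/
abbrev Plane : Type := EuclideanSpace ℝ (Fin 2)

/-- The conditions on the power gain `r ↦ g(r, z)` as a function of the link length `r > 0`:
continuous, strictly decreasing, and vanishing at infinity. -/
structure IsPathGain (h : ℝ → ℝ) : Prop where
  continuousOn : ContinuousOn h (Ioi 0)
  strictAntiOn : StrictAntiOn h (Ioi 0)
  tendsto_zero : Tendsto h atTop (𝓝 0)

/-- Received power `P · g(|p - q|, z)` over a link from `p` to `q` with propagation effect `z`. -/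
noncomputable def rxPower (P : ℝ) (g : ℝ → ℝ → ℝ) (p q : Plane) (z : ℝ) : ℝ :=
  P * g (dist p q) z

/-- The maximum secrecy rate of the Gaussian wiretap channel with received powers `pl` (legitimate
receiver) and `pe` (eavesdropper), and noise powers `sl`, `se`. -/
noncomputable def maxSecrecyRate (sl se pl pe : ℝ) : ℝ :=
  max (Real.logb 2 (1 + pl / sl) - Real.logb 2 (1 + pe / se)) 0

section Graph

variable {ι κ : Type*}

/-- Eavesdropper `k` attains `argmax_k P_rx(x_i, e_k)`.  Legitimate nodes are indexed by `ι` with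
positions `x`, eavesdroppers by `κ` with positions `e`, and `z` gives the propagation effect of
every link, a link being an unordered pair of nodes (channel reciprocity). -/
def IsStrongestEve (P : ℝ) (g : ℝ → ℝ → ℝ) (x : ι → Plane) (e : κ → Plane)
    (z : Sym2 (ι ⊕ κ) → ℝ) (i : ι) (k : κ) : Prop :=
  ∀ k' : κ, rxPower P g (x i) (e k') (z s(Sum.inl i, Sum.inr k'))
    ≤ rxPower P g (x i) (e k) (z s(Sum.inl i, Sum.inr k))

/-- The intrinsically secure communications graph with secrecy rate threshold `rho` and noise
powers `sl`, `se`: there is an edge from `i` to `j ≠ i` when the maximum secrecy rate of that link,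
against the eavesdropper with the strongest received power from `i`, exceeds `rho`. -/
def iSGraph (P sl se rho : ℝ) (g : ℝ → ℝ → ℝ) (x : ι → Plane) (e : κ → Plane)
    (z : Sym2 (ι ⊕ κ) → ℝ) : Digraph ι where
  Adj i j := i ≠ j ∧ ∃ k : κ, IsStrongestEve P g x e z i k ∧
    rho < maxSecrecyRate sl se
      (rxPower P g (x i) (x j) (z s(Sum.inl i, Sum.inl j)))
      (rxPower P g (x i) (e k) (z s(Sum.inl i, Sum.inr k)))

/-- Number of edges leaving `v`. -/
noncomputable def outDegree (G : Digraph ι) (v : ι) : ℕ∞ := {w | G.Adj v w}.encard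

/-- Number of edges entering `v`. -/
noncomputable def inDegree (G : Digraph ι) (v : ι) : ℕ∞ := {w | G.Adj w v}.encard

end Graph

section Poisson

variable {Ω : Type*} [MeasurableSpace Ω]

/-- Number of points of the random sequence `X` that lie in `A`. -/
noncomputable def pointCount (X : ℕ → Ω → Plane) (A : Set Plane) (ω : Ω) : ℕ∞ :=
  {i | X i ω ∈ A}.encard

/-- The points `X 0, X 1, …` (in some enumeration) form a homogeneous Poisson point process on the
plane with density `lam`: the number of points in a Borel set of finite area is Poisson distributed
with mean `lam` times the area, and the numbers of points in disjoint Borel sets are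
independent. -/
structure IsPoissonProcess (lam : ℝ≥0) (X : ℕ → Ω → Plane) (μ : Measure Ω) : Prop where
  measurable : ∀ i, Measurable (X i)
  count_law : ∀ A : Set Plane, MeasurableSet A → volume A ≠ ∞ → ∀ n : ℕ,
    μ {ω | pointCount X A ω = n} = poissonMeasure (lam * (volume A).toNNReal) {n}
  count_indep : ∀ (m : ℕ) (A : Fin m → Set Plane), (∀ a, MeasurableSet (A a)) →
    Pairwise (fun a b => Disjoint (A a) (A b)) →
    iIndepFun (fun a ω => pointCount X (A a) ω) μ

/-- Node positions `Π_ℓ ∪ {0}`: the node `none` is the typical node, placed at the origin. -/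
def withOrigin (X : ℕ → Ω → Plane) (ω : Ω) : Option ℕ → Plane
  | none => 0
  | some i => X i ω

/-- The links of the network: unordered pairs of two different nodes, a node being the typical
node or a legitimate node (`Option ℕ`), or an eavesdropper (`ℕ`). -/
abbrev Link : Type := {s : Sym2 (Option ℕ ⊕ ℕ) // ¬ s.IsDiag}

/-- The random elements of a Poisson network with propagation effects: legitimate nodes `X` and
eavesdroppers `Y` are independent Poisson processes with densities `lamL`, `lamE`, and the
propagation effects `Z` of the links are i.i.d. with law `ν`, independent of the positions. -/
structure IsPoissonNetwork (lamL lamE : ℝ≥0) (ν : Measure ℝ) (X Y : ℕ → Ω → Plane)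
    (Z : Sym2 (Option ℕ ⊕ ℕ) → Ω → ℝ) (μ : Measure Ω) : Prop where
  legit_poisson : IsPoissonProcess lamL X μ
  eve_poisson : IsPoissonProcess lamE Y μ
  measurable_effect : ∀ s : Link, Measurable (Z s)
  effect_law : ∀ s : Link, μ.map (Z s) = ν
  effect_indep : iIndepFun (fun (s : Link) ω => Z s ω) μ
  positions_indep : IndepFun (fun ω i => X i ω) (fun ω i => Y i ω) μ
  positions_effects_indep :
    IndepFun (fun ω => ((fun i => X i ω), (fun i => Y i ω))) (fun ω (s : Link) => Z s ω) μ

/-- The random secrecy graph on `Π_ℓ ∪ {0}`, with zero secrecy rate threshold and equal noise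
powers `s`. -/
def poissonISGraph (P s : ℝ) (g : ℝ → ℝ → ℝ) (X Y : ℕ → Ω → Plane)
    (Z : Sym2 (Option ℕ ⊕ ℕ) → Ω → ℝ) (ω : Ω) : Digraph (Option ℕ) :=
  iSGraph P s s 0 g (withOrigin X ω) (fun k => Y k ω) (fun l => Z l ω)

end Poisson

end SecrecyGraph

/-! Let `η` be the image of area times `ν` under `(y, z) ↦ P g(|y|, z)`, called `powerMeasure`. By
marking and mapping, the powers at the origin from legitimate nodes and from eavesdroppers are
independent Poisson processes on the line with intensities `lamL • η` and `lamE • η`. The whole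
dependence on `ν` and `g` sits in `η`, and it cancels as follows.

An edge leaves the origin exactly when the power of that link exceeds the largest eavesdropper power
`m`. Given `m`, the out-degree is Poisson with mean `(lamL / lamE) * U`, where `U = lamE η(m, ∞)`.
Since `η` has no atoms, `U > u` says that no eavesdropper power reaches the level `s` with `lamE
η[s, ∞) = u`, an event of probability `exp (-u)`. So `U` is a unit exponential variable
(`HasMaxTail.measure_lt_iInf`), and with `a = lamL / lamE` the generating function at `c` is `1 / (1
+ a (1 - c))` (`lintegral_enatPow_count_above`), that of a geometric law.

For the in-degree, the law of the eavesdropper powers seen from a fixed point does not depend on the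
point, and legitimate positions are independent of eavesdroppers. With reciprocity of the link, `i →
0` and `0 → i` have the same probability (`measure_adj_comm`). Summing over `i` equates the two
means, although the two laws need not agree.

Poisson processes are handled through the functional `E ∏ F(W i) = exp (-∫ (1 - F))`, which is
stable under marking and mapping and yields all count statistics. Existence of a strongest
eavesdropper for the origin is converted into a condition on `η` alone (`HasMaxTail`), and hence
carries over to every other node. -/

namespace SecrecyGraph

/-! ### Exponentials and infinite products in `[0, ∞]`. -/

/-- The function `x ↦ exp (-x)` on `[0, ∞]`. -/
noncomputable def expNeg (x : ℝ≥0∞) : ℝ≥0∞ := EReal.exp (-(x : EReal))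

@[simp] lemma expNeg_zero : expNeg 0 = 1 := by simp [expNeg]

@[simp] lemma expNeg_top : expNeg ∞ = 0 := by simp [expNeg]

lemma expNeg_add (x y : ℝ≥0∞) : expNeg (x + y) = expNeg x * expNeg y := by
  rw [expNeg, EReal.coe_ennreal_add, EReal.neg_add, sub_eq_add_neg, EReal.exp_add]
  · rfl
  · exact Or.inl (by simp)
  · exact Or.inr (by simp)

lemma expNeg_sum {ι : Type*} (s : Finset ι) (f : ι → ℝ≥0∞) :
    expNeg (∑ i ∈ s, f i) = ∏ i ∈ s, expNeg (f i) := by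
  classical
  induction s using Finset.induction_on with
  | empty => simp
  | insert a s ha ih => rw [Finset.sum_insert ha, Finset.prod_insert ha, expNeg_add, ih]

lemma expNeg_ofReal {x : ℝ} (hx : 0 ≤ x) :
    expNeg (ENNReal.ofReal x) = ENNReal.ofReal (Real.exp (-x)) := by
  rw [expNeg, EReal.coe_ennreal_ofReal, max_eq_left hx, ← EReal.coe_neg, EReal.exp_coe]

lemma expNeg_antitone : Antitone expNeg := fun _ _ h => by
  rw [expNeg, expNeg, EReal.exp_le_exp_iff, EReal.neg_le_neg_iff]
  exact_mod_cast h

lemma continuous_expNeg : Continuous expNeg :=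
  ENNReal.continuous_exp.comp (continuous_neg.comp continuous_coe_ennreal_ereal)

lemma expNeg_le_one (x : ℝ≥0∞) : expNeg x ≤ 1 := by
  simpa using expNeg_antitone (zero_le (a := x))

lemma expNeg_ne_zero {x : ℝ≥0∞} (hx : x ≠ ∞) : expNeg x ≠ 0 := by
  rw [← ENNReal.ofReal_toReal hx, expNeg_ofReal ENNReal.toReal_nonneg]
  simp [Real.exp_pos]

/-- The infinite product of a sequence in `[0, 1]`. -/
noncomputable def infProd (f : ℕ → ℝ≥0∞) : ℝ≥0∞ := ⨅ m, ∏ i ∈ Finset.range m, f i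

lemma antitone_prod_range {f : ℕ → ℝ≥0∞} (hf : ∀ i, f i ≤ 1) :
    Antitone fun m => ∏ i ∈ Finset.range m, f i :=
  antitone_nat_of_succ_le fun m => by
    rw [Finset.prod_range_succ]
    exact mul_le_of_le_one_right' (hf m)

lemma tendsto_infProd {f : ℕ → ℝ≥0∞} (hf : ∀ i, f i ≤ 1) :
    Tendsto (fun m => ∏ i ∈ Finset.range m, f i) atTop (𝓝 (infProd f)) :=
  tendsto_atTop_iInf (antitone_prod_range hf)

lemma infProd_mono {f g : ℕ → ℝ≥0∞} (h : ∀ i, f i ≤ g i) : infProd f ≤ infProd g :=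
  iInf_mono fun _ => Finset.prod_le_prod' fun i _ => h i

lemma infProd_le_one (f : ℕ → ℝ≥0∞) : infProd f ≤ 1 := by
  exact (iInf_le (fun m => ∏ i ∈ Finset.range m, f i) 0).trans_eq (by simp)

lemma infProd_finset_prod {ι : Type*} (s : Finset ι) (f : ι → ℕ → ℝ≥0∞)
    (hf : ∀ c i, f c i ≤ 1) :
    infProd (fun i => ∏ c ∈ s, f c i) = ∏ c ∈ s, infProd (f c) := by
  refine tendsto_nhds_unique (tendsto_infProd fun i => Finset.prod_le_one' fun c _ => hf c i) ?_
  simp_rw [Finset.prod_comm (t := s)]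
  exact ENNReal.tendsto_finsetProd_of_ne_top s (fun c _ => tendsto_infProd (hf c))
    fun c _ => ((infProd_le_one _).trans_lt ENNReal.one_lt_top).ne

/-- Two infima commute, and for a finite product the decreasing limit passes through by continuity
of multiplication at finite values. -/
lemma infProd_iInf {f : ℕ → ℕ → ℝ≥0∞} (hf : ∀ i, Antitone fun n => f n i)
    (h1 : ∀ n i, f n i ≤ 1) :
    infProd (fun i => ⨅ n, f n i) = ⨅ n, infProd (f n) := by
  unfold infProd
  rw [iInf_comm]
  refine iInf_congr fun m => ?_
  refine tendsto_nhds_unique (f := fun n => ∏ i ∈ Finset.range m, f n i) (l := atTop)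
    (ENNReal.tendsto_finsetProd_of_ne_top _ (fun i _ => tendsto_atTop_iInf (hf i))
      fun i _ => (((iInf_le _ 0).trans (h1 0 i)).trans_lt ENNReal.one_lt_top).ne) ?_
  exact tendsto_atTop_iInf fun a b hab => Finset.prod_le_prod' fun i _ => hf i hab

/-- The power `c ^ k` for `c ≤ 1` and an exponent that may be infinite. -/
noncomputable def enatPow (c : ℝ≥0∞) (k : ℕ∞) : ℝ≥0∞ := ⨅ n : ℕ, ⨅ _ : (n : ℕ∞) ≤ k, c ^ n

lemma enatPow_coe {c : ℝ≥0∞} (hc : c ≤ 1) (k : ℕ) : enatPow c k = c ^ k :=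
  le_antisymm (iInf₂_le (f := fun (n : ℕ) (_ : (n : ℕ∞) ≤ k) => c ^ n) k le_rfl)
    (le_iInf₂ fun _ hn => pow_le_pow_right_of_le_one' hc (by exact_mod_cast hn))

lemma enatPow_top {c : ℝ≥0∞} (hc : c < 1) : enatPow c ⊤ = 0 :=
  le_antisymm (ge_of_tendsto' (ENNReal.tendsto_pow_atTop_nhds_zero_of_lt_one hc)
    fun n => iInf₂_le n le_top) zero_le

/-- This turns the product functional of a two-valued function into the generating function of a
count, infinite counts included. -/
lemma infProd_ite (p : ℕ → Prop) [DecidablePred p] {c : ℝ≥0∞} (hc : c ≤ 1) :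
    infProd (fun i => if p i then c else 1) = enatPow c {i | p i}.encard := by
  have hprod : ∀ m, ∏ i ∈ Finset.range m, (if p i then c else 1)
      = c ^ ((Finset.range m).filter p).card := fun m => by
    rw [Finset.prod_ite]; simp
  unfold infProd
  simp_rw [hprod]
  refine le_antisymm (le_iInf₂ fun n hn => ?_) (le_iInf fun m => iInf₂_le _ ?_)
  · obtain ⟨t, hts, htn⟩ := Set.exists_subset_encard_eq hn
    have htf : t.Finite := Set.finite_of_encard_eq_coe htn
    obtain ⟨b, hb⟩ := htf.bddAbove
    refine (iInf_le _ (b + 1)).trans (pow_le_pow_right_of_le_one' hc ?_)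
    have : t.encard ≤ (((Finset.range (b + 1)).filter p : Finset ℕ) : Set ℕ).encard :=
      Set.encard_le_encard fun i hi => by
        simpa [Nat.lt_succ_iff] using ⟨hb hi, hts hi⟩
    rw [htn, Set.encard_coe_eq_coe_finsetCard] at this
    exact_mod_cast this
  · rw [← Set.encard_coe_eq_coe_finsetCard]
    exact Set.encard_le_encard fun i hi => (by simpa using hi : _ ∧ _).2

section Measure

variable {Ω : Type*} [MeasurableSpace Ω]

lemma measurable_infProd {f : ℕ → Ω → ℝ≥0∞} (hf : ∀ i, Measurable (f i)) :
    Measurable fun ω => infProd fun i => f i ω :=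
  Measurable.iInf fun _ => Finset.measurable_fun_prod _ fun i _ => hf i

lemma lintegral_infProd {μ : Measure Ω} [IsProbabilityMeasure μ] {f : ℕ → Ω → ℝ≥0∞}
    (hf : ∀ i, Measurable (f i)) (h1 : ∀ i ω, f i ω ≤ 1) :
    ∫⁻ ω, infProd (fun i => f i ω) ∂μ = ⨅ m, ∫⁻ ω, ∏ i ∈ Finset.range m, f i ω ∂μ := by
  unfold infProd
  refine lintegral_iInf (fun _ => Finset.measurable_fun_prod _ fun i _ => hf i) ?_ (by simp)
  exact fun a b hab ω => antitone_prod_range (fun i => h1 i ω) hab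

end Measure

/-! ### The Laplace functional of a planar Poisson process. -/

section

variable {Ω : Type*} [MeasurableSpace Ω]

/-- The random points `W 0, W 1, …` have the Laplace functional of a Poisson process with
intensity measure `M`. -/
def HasPoissonLaplace {E : Type*} [MeasurableSpace E] (W : ℕ → Ω → E) (M : Measure E)
    (μ : Measure Ω) : Prop :=
  ∀ F : E → ℝ≥0∞, Measurable F → (∀ x, F x ≤ 1) →
    ∫⁻ ω, infProd (fun i => F (W i ω)) ∂μ = expNeg (∫⁻ x, (1 - F x) ∂M)

lemma lintegral_pow_poissonMeasure (r : ℝ≥0) {c : ℝ≥0∞} (hc : c ≤ 1) :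
    ∫⁻ n, c ^ n ∂(poissonMeasure r) = expNeg (r * (1 - c)) := by
  lift c to ℝ≥0 using (hc.trans_lt ENNReal.one_lt_top).ne
  have hc1 : c ≤ 1 := by exact_mod_cast hc
  have hs : HasSum (fun n : ℕ => Real.exp (-r) * r ^ n / (n.factorial : ℝ) * (c : ℝ) ^ n)
      (Real.exp (-(r * (1 - c)))) := by
    have := (NormedSpace.expSeries_div_hasSum_exp ((r : ℝ) * c)).mul_left (Real.exp (-r))
    rw [← Real.exp_eq_exp_ℝ, ← Real.exp_add] at this
    convert! this using 1
    · ext n; rw [mul_pow]; ring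
    · congr 1; ring
  have h1 : (r : ℝ≥0∞) * (1 - c) = ENNReal.ofReal ((r : ℝ) * (1 - c)) := by
    rw [ENNReal.ofReal_mul r.coe_nonneg, ENNReal.ofReal_sub _ c.coe_nonneg]
    simp
  rw [h1, expNeg_ofReal (mul_nonneg r.coe_nonneg (sub_nonneg.2 (by exact_mod_cast hc1))), ← hs.tsum_eq,
    ENNReal.ofReal_tsum_of_nonneg (fun n => by positivity) hs.summable, lintegral_countable']
  refine tsum_congr fun n => ?_
  rw [poissonMeasure_singleton, ENNReal.ofReal_mul (by positivity), ENNReal.ofReal_pow c.coe_nonneg,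
    ENNReal.ofReal_coe_nnreal, mul_comm]

lemma measurable_setOf_encard {ι : Type*} [Countable ι] {p : ι → Ω → Prop}
    (hp : ∀ i, MeasurableSet {ω | p i ω}) : Measurable fun ω => {i | p i ω}.encard :=
  measurable_encard.comp (measurable_set_iff.2 fun i => measurable_to_prop (by
    convert! hp i using 1
    ext; simp))

lemma IsPoissonProcess.measurable_pointCount {lam : ℝ≥0} {X : ℕ → Ω → Plane} {μ : Measure Ω}
    (h : IsPoissonProcess lam X μ) {A : Set Plane} (hA : MeasurableSet A) :
    Measurable (pointCount X A) :=
  measurable_setOf_encard fun i => h.measurable i hA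

/-- The Poisson masses of the finite values already sum to one, so a one-sided comparison of the two
probability measures suffices and the value `⊤` needs no separate treatment. -/
lemma IsPoissonProcess.map_pointCount {lam : ℝ≥0} {X : ℕ → Ω → Plane} {μ : Measure Ω}
    [IsProbabilityMeasure μ] (h : IsPoissonProcess lam X μ) {A : Set Plane}
    (hA : MeasurableSet A) (hfin : volume A ≠ ∞) :
    μ.map (pointCount X A) =
      (poissonMeasure (lam * (volume A).toNNReal)).map ((↑) : ℕ → ℕ∞) := by
  have hm := h.measurable_pointCount hA
  have : IsProbabilityMeasure (μ.map (pointCount X A)) :=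
    Measure.isProbabilityMeasure_map hm.aemeasurable
  symm
  refine Measure.eq_of_le_of_isProbabilityMeasure (Measure.le_iff.2 fun s hs => ?_)
  have hsu : s ⊇ ⋃ n : ((↑) : ℕ → ℕ∞) ⁻¹' s, {((n : ℕ) : ℕ∞)} :=
    iUnion_subset fun n => singleton_subset_iff.2 n.2
  refine le_trans ?_ (measure_mono hsu)
  rw [measure_iUnion (fun a b hab => by
    simpa using fun h => hab (Subtype.ext h)) fun n => MeasurableSet.of_discrete,
    Measure.map_apply measurable_from_top hs,
    ← Measure.tsum_indicator_apply_singleton _ _ MeasurableSet.of_discrete,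
    ← tsum_subtype (((↑) : ℕ → ℕ∞) ⁻¹' s)]
  refine (tsum_congr fun n => ?_).le
  rw [Measure.map_apply hm MeasurableSet.of_discrete, ← h.count_law A hA hfin n]
  rfl

lemma IsPoissonProcess.lintegral_enatPow {lam : ℝ≥0} {X : ℕ → Ω → Plane} {μ : Measure Ω}
    [IsProbabilityMeasure μ] (h : IsPoissonProcess lam X μ) {A : Set Plane}
    (hA : MeasurableSet A) (hfin : volume A ≠ ∞) {c : ℝ≥0∞} (hc : c ≤ 1) :
    ∫⁻ ω, enatPow c (pointCount X A ω) ∂μ = expNeg (lam * volume A * (1 - c)) := by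
  rw [← lintegral_map (f := enatPow c) measurable_from_top (h.measurable_pointCount hA),
    h.map_pointCount hA hfin, lintegral_map measurable_from_top measurable_from_top]
  simp_rw [enatPow_coe hc]
  rw [lintegral_pow_poissonMeasure _ hc, ENNReal.coe_mul, ENNReal.coe_toNNReal hfin]

lemma IsPoissonProcess.lintegral_infProd_simpleFunc {lam : ℝ≥0} {X : ℕ → Ω → Plane}
    {μ : Measure Ω} [IsProbabilityMeasure μ] (h : IsPoissonProcess lam X μ)
    (f : SimpleFunc Plane ℝ≥0∞) (hf1 : ∀ x, f x ≤ 1) (hfin : ∀ c ≠ 0, volume (f ⁻¹' {c}) ≠ ∞) :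
    ∫⁻ ω, infProd (fun i => 1 - f (X i ω)) ∂μ = expNeg (lam * ∫⁻ x, f x) := by
  classical
  -- The value `0` is dropped: its level set may have infinite area, and it contributes only factors
  -- `1`. The other level sets are disjoint with finite area, so their counts are independent
  -- Poisson variables.
  set s := f.range.filter (· ≠ 0)
  have hpt : ∀ ω, infProd (fun i => 1 - f (X i ω))
      = ∏ c : s, enatPow (1 - c) (pointCount X (f ⁻¹' {(c : ℝ≥0∞)}) ω) := fun ω => by
    have hone : ∀ x, 1 - f x = ∏ c : s, if x ∈ f ⁻¹' {(c : ℝ≥0∞)} then 1 - (c : ℝ≥0∞) else 1 := by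
      intro x
      rw [Finset.prod_coe_sort s (fun c => if x ∈ f ⁻¹' {c} then 1 - c else 1)]
      simp only [mem_preimage, mem_singleton_iff]
      rw [Finset.prod_ite_eq s (f x) (fun c => 1 - c)]
      split_ifs with hx
      · rfl
      · have : f x = 0 := by
          by_contra h0
          exact hx (Finset.mem_filter.2 ⟨f.mem_range_self x, h0⟩)
        simp [this]
    simp_rw [hone]
    rw [infProd_finset_prod _ (fun (c : s) i =>
      if X i ω ∈ f ⁻¹' {(c : ℝ≥0∞)} then 1 - (c : ℝ≥0∞) else 1)]
    · refine Finset.prod_congr rfl fun c _ => ?_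
      rw [infProd_ite (fun i => X i ω ∈ f ⁻¹' {(c : ℝ≥0∞)}) tsub_le_self]
      rfl
    · intro c i
      split_ifs
      · exact tsub_le_self
      · exact le_rfl
  have hind : iIndepFun (fun (c : s) ω => pointCount X (f ⁻¹' {(c : ℝ≥0∞)}) ω) μ := by
    have h0 := h.count_indep (Fintype.card s)
      (fun a => f ⁻¹' {(((Fintype.equivFin s).symm a : s) : ℝ≥0∞)})
      (fun a => f.measurableSet_fiber _) fun a b hab => by
        refine Disjoint.preimage _ (disjoint_singleton.2 fun hc => hab ?_)
        exact (Fintype.equivFin s).symm.injective (Subtype.ext hc)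
    have h1 := h0.precomp (Fintype.equivFin s).injective
    simpa [Function.comp_def] using h1
  have hind2 := hind.comp (fun (c : s) k => enatPow (1 - (c : ℝ≥0∞)) k)
    fun c => measurable_from_top
  simp_rw [hpt]
  have := lintegral_prod_eq_prod_lintegral_of_indepFun Finset.univ _ hind2 fun c =>
    measurable_from_top.comp (h.measurable_pointCount (f.measurableSet_fiber _))
  refine this.trans ?_
  rw [SimpleFunc.lintegral_eq_lintegral, SimpleFunc.lintegral, Finset.mul_sum,
    ← Finset.sum_filter_of_ne (p := (· ≠ 0)) (s := f.range) (fun c _ hc h0 => hc (by simp [h0])),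
    ← Finset.sum_coe_sort, expNeg_sum]
  refine Finset.prod_congr rfl fun c _ => ?_
  have hc : (c : ℝ≥0∞) ∈ f.range ∧ (c : ℝ≥0∞) ≠ 0 := Finset.mem_filter.1 c.2
  have hc1 : (c : ℝ≥0∞) ≤ 1 := by
    obtain ⟨x, hx⟩ := SimpleFunc.mem_range.1 hc.1
    exact hx ▸ hf1 x
  refine (h.lintegral_enatPow (f.measurableSet_fiber _) (hfin _ hc.2) tsub_le_self).trans ?_
  rw [ENNReal.sub_sub_cancel ENNReal.one_ne_top hc1, mul_assoc, mul_comm (volume _)]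

theorem IsPoissonProcess.hasPoissonLaplace {lam : ℝ≥0} {X : ℕ → Ω → Plane} {μ : Measure Ω}
    [IsProbabilityMeasure μ] (h : IsPoissonProcess lam X μ) :
    HasPoissonLaplace X (lam • volume) μ := by
  intro F hF hF1
  set H : Plane → ℝ≥0∞ := fun x => 1 - F x
  have hH : Measurable H := measurable_const.sub hF
  -- Cutting off to balls gives the nonzero level sets finite area, while the sequence still
  -- increases pointwise to `1 - F`.
  let f : ℕ → SimpleFunc Plane ℝ≥0∞ := fun n =>
    (SimpleFunc.eapprox H n).restrict (Metric.ball 0 n)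
  have hfa : ∀ n x, f n x = (Metric.ball (0 : Plane) n).indicator (SimpleFunc.eapprox H n) x :=
    fun n x => SimpleFunc.restrict_apply _ measurableSet_ball x
  have hmono : ∀ x, Monotone fun n => f n x := fun x a b hab => by
    simp only [hfa]
    refine (indicator_le_indicator (SimpleFunc.monotone_eapprox H hab x)).trans ?_
    exact indicator_le_indicator_of_subset (Metric.ball_subset_ball (by exact_mod_cast hab))
      (fun _ => zero_le) x
  have hsup : ∀ x, Tendsto (fun n => f n x) atTop (𝓝 (H x)) := fun x => by
    rw [← SimpleFunc.iSup_eapprox_apply hH x]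
    refine (tendsto_atTop_iSup fun a b hab => SimpleFunc.monotone_eapprox H hab x).congr' ?_
    obtain ⟨N, hN⟩ := exists_nat_gt ‖x‖
    filter_upwards [eventually_ge_atTop N] with n hn
    rw [hfa, indicator_of_mem]
    simpa using hN.trans_le (by exact_mod_cast hn)
  have hle : ∀ n x, f n x ≤ H x := fun n x => (hmono x).ge_of_tendsto (hsup x) n
  have hf1 : ∀ n x, f n x ≤ 1 := fun n x => (hle n x).trans tsub_le_self
  have hfin : ∀ n, ∀ c ≠ 0, volume (f n ⁻¹' {c}) ≠ ∞ := fun n c hc => by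
    refine ((measure_mono fun x hx => ?_).trans_lt
      (measure_ball_lt_top (μ := volume) (x := (0 : Plane)) (r := n))).ne
    by_contra hxb
    rw [mem_preimage, mem_singleton_iff, hfa, indicator_of_notMem hxb] at hx
    exact hc hx.symm
  have hFi : ∀ x, F x = ⨅ n, (1 - f n x) := fun x => by
    refine tendsto_nhds_unique ?_ (tendsto_atTop_iInf fun a b hab => tsub_le_tsub_left (hmono x hab) 1)
    have := ENNReal.Tendsto.sub (tendsto_const_nhds (x := (1 : ℝ≥0∞))) (hsup x)
      (Or.inl ENNReal.one_ne_top)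
    simpa [H, ENNReal.sub_sub_cancel ENNReal.one_ne_top (hF1 x)] using this
  have h1 : ∀ ω, infProd (fun i => F (X i ω)) = ⨅ n, infProd fun i => 1 - f n (X i ω) := fun ω => by
    simp_rw [hFi]
    exact infProd_iInf (f := fun n i => 1 - f n (X i ω))
      (fun i a b hab => tsub_le_tsub_left (hmono _ hab) 1) fun n i => tsub_le_self
  have hmeas : ∀ n, Measurable fun ω => infProd fun i => 1 - f n (X i ω) := fun n =>
    measurable_infProd fun i => measurable_const.sub ((f n).measurable.comp (h.measurable i))
  have hanti : Antitone fun n ω => infProd fun i => 1 - f n (X i ω) := fun a b hab ω =>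
    infProd_mono fun i => tsub_le_tsub_left (hmono _ hab) 1
  simp_rw [h1]
  rw [lintegral_iInf hmeas hanti
    ((lintegral_mono fun ω => infProd_le_one _).trans_lt (by simp)).ne]
  simp_rw [h.lintegral_infProd_simpleFunc (f _) (hf1 _) (hfin _)]
  refine tendsto_nhds_unique (tendsto_atTop_iInf fun a b hab => expNeg_antitone ?_)
    ((continuous_expNeg.tendsto _).comp ?_)
  · exact mul_le_mul_right (lintegral_mono fun x => hmono x hab) _
  · rw [lintegral_smul_measure]
    exact ENNReal.Tendsto.const_mul (lintegral_tendsto_of_tendsto_of_monotone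
      (fun n => (f n).measurable.aemeasurable) (ae_of_all _ hmono) (ae_of_all _ hsup))
      (Or.inr ENNReal.coe_ne_top)

end

/-! ### Marking, mapping and counts for Poisson processes. -/

section

variable {Ω E : Type*} [MeasurableSpace Ω] [MeasurableSpace E] {W : ℕ → Ω → E} {M : Measure E}
  {μ : Measure Ω}

lemma HasPoissonLaplace.map {E' : Type*} [MeasurableSpace E'] (h : HasPoissonLaplace W M μ)
    {v : E → E'} (hv : Measurable v) : HasPoissonLaplace (fun i ω => v (W i ω)) (M.map v) μ := by
  intro F hF hF1
  rw [lintegral_map (f := fun x => 1 - F x) (measurable_const.sub hF) hv]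
  exact h (F ∘ v) (hF.comp hv) fun x => hF1 _

lemma hasPoissonLaplace_map_iff {Ω' : Type*} [MeasurableSpace Ω'] {μ' : Measure Ω'} {T : Ω' → Ω}
    (hT : Measurable T) (hW : ∀ i, Measurable (W i)) :
    HasPoissonLaplace W M (μ'.map T) ↔ HasPoissonLaplace (fun i ω => W i (T ω)) M μ' := by
  refine forall₃_congr fun F hF _ => ?_
  rw [lintegral_map (f := fun ω => infProd fun i => F (W i ω))
    (measurable_infProd fun i => hF.comp (hW i)) hT]

/-- Marking theorem: independent marks turn a Poisson process with intensity `M` into a Poisson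
process with intensity `M.prod ν`. -/
theorem HasPoissonLaplace.prod_marks [IsProbabilityMeasure μ] {S : Type*} [MeasurableSpace S]
    (h : HasPoissonLaplace W M μ) (hW : ∀ i, Measurable (W i)) (ν : Measure S)
    [IsProbabilityMeasure ν] :
    HasPoissonLaplace (fun i (p : Ω × (ℕ → S)) => (W i p.1, p.2 i)) (M.prod ν)
      (μ.prod (Measure.infinitePi fun _ => ν)) := by
  intro F hF hF1
  have hFx : ∀ x, Measurable fun z => F (x, z) := fun x => hF.comp measurable_prodMk_left
  have hφ : Measurable fun x => ∫⁻ z, F (x, z) ∂ν := hF.lintegral_prod_right'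
  have hφ1 : ∀ x, ∫⁻ z, F (x, z) ∂ν ≤ 1 := fun x =>
    (lintegral_mono fun z => hF1 (x, z)).trans (by simp)
  have hm : Measurable fun p : Ω × (ℕ → S) => infProd fun i => F (W i p.1, p.2 i) :=
    measurable_infProd fun i => hF.comp
      (((hW i).comp measurable_fst).prodMk ((measurable_pi_apply i).comp measurable_snd))
  have hm' : Measurable fun x => 1 - F x := measurable_const.sub hF
  rw [lintegral_prod _ hm.aemeasurable, lintegral_prod _ hm'.aemeasurable]
  have hsub : ∀ x, ∫⁻ z, (1 - F (x, z)) ∂ν = 1 - ∫⁻ z, F (x, z) ∂ν := fun x => by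
    rw [lintegral_sub (hFx x) ((hφ1 x).trans_lt ENNReal.one_lt_top).ne (ae_of_all _ fun z => hF1 _)]
    simp
  simp_rw [hsub]
  rw [← h _ hφ hφ1]
  -- With the positions frozen, the marks are independent, so integrating them out factorises the
  -- product and replaces `F` by its `ν`-average in the mark.
  refine lintegral_congr fun ω => ?_
  rw [lintegral_infProd (f := fun i (y : ℕ → S) => F (W i ω, y i))
    (fun i => (hFx (W i ω)).comp (measurable_pi_apply i)) fun i z => hF1 _]
  refine iInf_congr fun m => ?_
  have hind := iIndepFun_infinitePi (P := fun _ : ℕ => ν) (X := fun i z => F (W i ω, z))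
    fun i => hFx _
  rw [lintegral_prod_eq_prod_lintegral_of_indepFun _ _ hind
    fun i => (hFx (W i ω)).comp (measurable_pi_apply i)]
  refine Finset.prod_congr rfl fun i _ => ?_
  rw [← lintegral_map (f := fun z => F (W i ω, z)) (hFx _) (measurable_pi_apply i),
    Measure.infinitePi_map_eval]

lemma HasPoissonLaplace.lintegral_enatPow (h : HasPoissonLaplace W M μ) {B : Set E}
    (hB : MeasurableSet B) {c : ℝ≥0∞} (hc : c ≤ 1) :
    ∫⁻ ω, enatPow c {i | W i ω ∈ B}.encard ∂μ = expNeg ((1 - c) * M B) := by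
  classical
  have := h (fun x => if x ∈ B then c else 1) (Measurable.ite hB measurable_const measurable_const)
    fun x => by split_ifs <;> simp [hc]
  simp_rw [infProd_ite (fun i => W i _ ∈ B) hc] at this
  rw [this]
  congr 1
  rw [← lintegral_indicator_const hB]
  refine lintegral_congr fun x => ?_
  by_cases hx : x ∈ B <;> simp [hx]

/-- Void probabilities. -/
lemma HasPoissonLaplace.measure_forall_notMem (h : HasPoissonLaplace W M μ)
    (hW : ∀ i, Measurable (W i)) {B : Set E} (hB : MeasurableSet B) :
    μ {ω | ∀ i, W i ω ∉ B} = expNeg (M B) := by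
  -- With `0 ^ 0 = 1`, the power `0 ^ N` is the indicator of `N = 0`.
  have h0 := h.lintegral_enatPow hB (c := 0) zero_le_one
  rw [tsub_zero, one_mul] at h0
  have hms : MeasurableSet {ω | ∀ i, W i ω ∉ B} := by
    simp only [ofPred_forall]
    exact MeasurableSet.iInter fun i => hW i hB.compl
  rw [← h0, ← lintegral_indicator_one hms]
  refine lintegral_congr fun ω => ?_
  by_cases hω : ∀ i, W i ω ∉ B
  · have : {i | W i ω ∈ B} = ∅ := eq_empty_iff_forall_notMem.2 hω
    rw [indicator_of_mem (show ω ∈ {ω | ∀ i, W i ω ∉ B} from hω), this, encard_empty]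
    simpa using (enatPow_coe (c := 0) zero_le_one 0).symm
  · rw [indicator_of_notMem (show ω ∉ {ω | ∀ i, W i ω ∉ B} from hω)]
    push Not at hω
    refine le_antisymm zero_le ((iInf₂_le 1 ?_).trans_eq (by simp))
    exact_mod_cast one_le_encard_iff_nonempty.2 hω

/-- With `N` the count, the mean of `2 ^ (-N)` is `exp (-∞) = 0`, so `2 ^ (-N)` vanishes almost
surely. -/
lemma HasPoissonLaplace.ae_infinite (h : HasPoissonLaplace W M μ)
    (hW : ∀ i, Measurable (W i)) {B : Set E} (hB : MeasurableSet B) (hM : M B = ∞) :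
    ∀ᵐ ω ∂μ, {i | W i ω ∈ B}.Infinite := by
  have h0 := h.lintegral_enatPow hB (c := 2⁻¹) (by simp)
  rw [hM, ENNReal.one_sub_inv_two, ENNReal.mul_top (by simp), expNeg_top,
    lintegral_eq_zero_iff (f := fun ω => enatPow 2⁻¹ {i | W i ω ∈ B}.encard)
      ((measurable_from_top (f := enatPow 2⁻¹)).comp (measurable_setOf_encard fun i => hW i hB))] at h0
  filter_upwards [h0] with ω hω hfin
  rw [hfin.encard_eq_coe, enatPow_coe (by simp)] at hω
  simp at hω

/-- For `c < 1` the mean of `c ^ N` is at most the probability that `N` is finite; as `c` increases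
to `1` this mean tends to `1`. -/
lemma HasPoissonLaplace.ae_finite [IsProbabilityMeasure μ] (h : HasPoissonLaplace W M μ)
    (hW : ∀ i, Measurable (W i)) {B : Set E} (hB : MeasurableSet B) (hM : M B ≠ ∞) :
    ∀ᵐ ω ∂μ, {i | W i ω ∈ B}.Finite := by
  have hms : MeasurableSet {ω | {i | W i ω ∈ B}.Finite} := by
    have : {ω | {i | W i ω ∈ B}.Finite} = (fun ω => {i | W i ω ∈ B}.encard) ⁻¹' {⊤}ᶜ := by
      ext ω; simp
    rw [this]
    exact measurable_setOf_encard (fun i => hW i hB) MeasurableSet.of_discrete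
  rw [ae_iff, ← compl_ofPred, prob_compl_eq_zero_iff hms]
  refine le_antisymm prob_le_one ?_
  have hlim : Tendsto (fun n : ℕ => expNeg ((n + 1 : ℝ≥0∞)⁻¹ * M B)) atTop (𝓝 1) := by
    rw [← expNeg_zero, ← zero_mul (M B)]
    refine (continuous_expNeg.tendsto _).comp (ENNReal.Tendsto.mul_const ?_ (Or.inr hM))
    simpa using (tendsto_add_atTop_iff_nat 1).2 ENNReal.tendsto_inv_nat_nhds_zero
  refine le_of_tendsto' hlim fun n => ?_
  have hn1 : ((n : ℝ≥0∞) + 1)⁻¹ ≤ 1 := ENNReal.inv_le_one.2 (by simp)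
  have := h.lintegral_enatPow hB (c := 1 - (n + 1 : ℝ≥0∞)⁻¹) tsub_le_self
  rw [ENNReal.sub_sub_cancel ENNReal.one_ne_top hn1] at this
  rw [← this, ← lintegral_indicator_one hms]
  refine lintegral_mono fun ω => ?_
  by_cases hω : {i | W i ω ∈ B}.Finite
  · rw [indicator_of_mem (show ω ∈ {ω | {i | W i ω ∈ B}.Finite} from hω)]
    exact (iInf₂_le 0 (by simp)).trans_eq (by simp)
  · rw [encard_eq_top hω, enatPow_top]
    · exact zero_le
    · exact ENNReal.sub_lt_self ENNReal.one_ne_top one_ne_zero (by simp)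

end

/-! ### The largest point of a Poisson process on the line. -/

section

variable {Ω : Type*} [MeasurableSpace Ω] {μ : Measure Ω} [IsProbabilityMeasure μ]

lemma HasPoissonLaplace.ae_forall_notMem {E : Type*} [MeasurableSpace E] {W : ℕ → Ω → E}
    {M : Measure E} (h : HasPoissonLaplace W M μ) (hW : ∀ i, Measurable (W i)) {B : Set E}
    (hB : MeasurableSet B) (hM : M B = 0) : ∀ᵐ ω ∂μ, ∀ i, W i ω ∉ B := by
  have h0 := h.measure_forall_notMem hW hB
  rw [hM, expNeg_zero] at h0
  have hms : MeasurableSet {ω | ∀ i, W i ω ∉ B} := by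
    simp only [ofPred_forall]
    exact MeasurableSet.iInter fun i => hW i hB.compl
  exact (mem_ae_iff_prob_eq_one hms).2 h0

/-- The condition on the intensity measure of a Poisson process on `ℝ` without fixed atoms under
which the process has a largest point. -/
structure HasMaxTail (η : Measure ℝ) : Prop where
  exists_ne_top : ∃ t, η (Ioi t) ≠ ∞
  exists_lt : ∀ s, η (Ioi s) ≠ ∞ → ∃ t < s, η (Ioi t) ≠ ∞

variable {η : Measure ℝ} {V : ℕ → Ω → ℝ}

/-- If every upper tail had infinite mass, the points would be unbounded above. If `η (Ioi s)` were
finite but every larger tail infinite, then with probability `exp (-η (Ioi s)) > 0` no point would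
exceed `s`, while points accumulate at `s` from below and none equals `s`. Either case excludes a
maximum. -/
lemma HasPoissonLaplace.hasMaxTail (h : HasPoissonLaplace V η μ) (hV : ∀ i, Measurable (V i))
    (hatom : ∀ t, η {t} = 0) (hmax : ∀ᵐ ω ∂μ, ∃ k, ∀ k', V k' ω ≤ V k ω) : HasMaxTail η where
  exists_ne_top := by
    by_contra! hcon
    have hinf : ∀ᵐ ω ∂μ, ∀ n : ℕ, {i | V i ω ∈ Ioi (n : ℝ)}.Infinite :=
      ae_all_iff.2 fun n => h.ae_infinite hV measurableSet_Ioi (hcon n)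
    obtain ⟨ω, ⟨k, hk⟩, hω⟩ := (hmax.and hinf).exists
    obtain ⟨n, hn⟩ := exists_nat_gt (V k ω)
    obtain ⟨i, hi⟩ := (hω n).nonempty
    exact absurd (hk i) (not_le.2 (hn.trans hi))
  exists_lt s hs := by
    by_contra! hcon
    have hinf : ∀ᵐ ω ∂μ, ∀ n : ℕ, {i | V i ω ∈ Ioi (s - 1 / ((n : ℝ) + 1))}.Infinite :=
      ae_all_iff.2 fun n => h.ae_infinite hV measurableSet_Ioi
        (hcon _ (sub_lt_self _ Nat.one_div_pos_of_nat))
    have hne := h.ae_forall_notMem hV (measurableSet_singleton s) (hatom s)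
    have h0 : μ {ω | ∀ i, V i ω ∉ Ioi s} = 0 := by
      refine measure_eq_zero_iff_ae_notMem.2 ?_
      filter_upwards [hmax, hinf, hne] with ω ⟨k, hk⟩ hω hneω hle
      have hlt : V k ω < s := lt_of_le_of_ne (not_lt.1 (hle k)) (hneω k)
      obtain ⟨n, hn⟩ := exists_nat_one_div_lt (sub_pos.2 hlt)
      obtain ⟨i, hi⟩ := (hω n).nonempty
      have := hk i
      have hi' : s - 1 / ((n : ℝ) + 1) < V i ω := hi
      linarith
    rw [h.measure_forall_notMem hV measurableSet_Ioi] at h0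
    exact expNeg_ne_zero hs h0

/-- At the threshold `sInf A` between infinite and finite tails, the tail itself is infinite by
`exists_lt`. So some point lies above the threshold, and only finitely many lie above any strictly
higher level; the largest of those is the maximum. -/
lemma HasMaxTail.ae_exists_max (hη : HasMaxTail η) (h0 : η (Ioi 0) = ∞)
    (h : HasPoissonLaplace V η μ) (hV : ∀ i, Measurable (V i)) :
    ∀ᵐ ω ∂μ, ∃ k, ∀ k', V k' ω ≤ V k ω := by
  set A := {t : ℝ | η (Ioi t) ≠ ∞}
  have hA : A.Nonempty := hη.exists_ne_top
  have hbdd : BddBelow A := ⟨0, fun t ht => by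
    by_contra! hlt
    exact ht (measure_mono_top (Ioi_subset_Ioi hlt.le) h0)⟩
  have htop : η (Ioi (sInf A)) = ∞ := by
    by_contra hne
    obtain ⟨t, hts, ht⟩ := hη.exists_lt _ hne
    exact absurd (csInf_le hbdd ht) (not_le.2 hts)
  have hfin : ∀ n : ℕ, η (Ioi (sInf A + 1 / ((n : ℝ) + 1))) ≠ ∞ := fun n => by
    obtain ⟨t, ht, hlt⟩ := exists_lt_of_csInf_lt hA
      (lt_add_of_pos_right (sInf A) (Nat.one_div_pos_of_nat (n := n) (α := ℝ)))
    exact ne_top_of_le_ne_top ht (measure_mono (Ioi_subset_Ioi hlt.le))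
  have hfin' := ae_all_iff.2 fun n => h.ae_finite hV measurableSet_Ioi (hfin n)
  filter_upwards [h.ae_infinite hV measurableSet_Ioi htop, hfin'] with ω hω hωn
  obtain ⟨i, hi⟩ := hω.nonempty
  obtain ⟨n, hn⟩ := exists_nat_one_div_lt (sub_pos.2 (show sInf A < V i ω from hi))
  have hi' : sInf A + 1 / ((n : ℝ) + 1) < V i ω := by linarith
  obtain ⟨k, hk, hkmax⟩ := Set.exists_max_image _ (fun k => V k ω) (hωn n) ⟨i, hi'⟩
  refine ⟨k, fun k' => ?_⟩
  by_cases hk' : sInf A + 1 / ((n : ℝ) + 1) < V k' ω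
  · exact hkmax k' hk'
  · exact (not_lt.1 hk').trans (le_of_lt hk)

/-- The level is the supremum of the `t` with `η (Ioi t) > u`. Continuity from below bounds the open
tail there by `u`, continuity from above bounds the closed tail below by `u`, and the two tails
agree for lack of atoms. -/
lemma HasMaxTail.exists_quantile (hη : HasMaxTail η) (h0 : η (Ioi 0) = ∞)
    (hatom : ∀ t, η {t} = 0) {u : ℝ≥0∞} (hu0 : u ≠ 0) (hu : u ≠ ∞) :
    ∃ s, η (Ici s) = u ∧ ∀ t, u < η (Ioi t) ↔ t < s := by
  set A := {t : ℝ | u < η (Ioi t)}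
  have hA : A.Nonempty := ⟨0, by simpa [A, h0] using hu.lt_top⟩
  have hbdd : BddAbove A := by
    obtain ⟨t, ht⟩ := hη.exists_ne_top
    have hlim : Tendsto (fun n : ℕ => η (Ioi (t + n))) atTop (𝓝 0) := by
      have := tendsto_measure_iInter_atTop (μ := η) (s := fun n : ℕ => Ioi (t + n))
        (fun n => measurableSet_Ioi.nullMeasurableSet)
        (fun a b hab => Ioi_subset_Ioi (by gcongr)) ⟨0, by simpa using ht⟩
      have hempty : ⋂ n : ℕ, Ioi (t + n) = ∅ := by
        refine eq_empty_iff_forall_notMem.2 fun x hx => ?_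
        obtain ⟨n, hn⟩ := exists_nat_gt (x - t)
        have : t + n < x := mem_iInter.1 hx n
        linarith
      rwa [hempty, measure_empty] at this
    obtain ⟨n, hn⟩ := (hlim.eventually (gt_mem_nhds (pos_iff_ne_zero.2 hu0))).exists
    refine ⟨t + n, fun x hx => ?_⟩
    by_contra! hlt
    exact absurd (hx.trans_le (measure_mono (Ioi_subset_Ioi hlt.le))) (not_lt.2 hn.le)
  have hpos : ∀ n : ℕ, 0 < 1 / ((n : ℝ) + 1) := fun n => Nat.one_div_pos_of_nat
  have hanti : Antitone fun n : ℕ => 1 / ((n : ℝ) + 1) := fun a b hab =>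
    Nat.one_div_le_one_div hab
  have hle : η (Ioi (sSup A)) ≤ u := by
    have := tendsto_measure_iUnion_atTop (μ := η)
      (s := fun n : ℕ => Ioi (sSup A + 1 / ((n : ℝ) + 1)))
      (fun a b hab => Ioi_subset_Ioi (by gcongr))
    have hU : ⋃ n : ℕ, Ioi (sSup A + 1 / ((n : ℝ) + 1)) = Ioi (sSup A) := by
      ext x
      simp only [mem_iUnion, mem_Ioi]
      refine ⟨fun ⟨n, hn⟩ => lt_trans (lt_add_of_pos_right _ (hpos n)) hn, fun hx => ?_⟩
      obtain ⟨n, hn⟩ := exists_nat_one_div_lt (sub_pos.2 hx)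
      exact ⟨n, by linarith⟩
    rw [hU] at this
    refine le_of_tendsto' this fun n => ?_
    by_contra! hlt
    exact absurd (le_csSup hbdd hlt) (not_le.2 (lt_add_of_pos_right _ (hpos n)))
  have hiff : ∀ t, u < η (Ioi t) ↔ t < sSup A := fun t => by
    refine ⟨fun ht => ?_, fun ht => ?_⟩
    · by_contra! hlt
      exact absurd (ht.trans_le (measure_mono (Ioi_subset_Ioi hlt))) (not_lt.2 hle)
    · obtain ⟨t', ht', hlt⟩ := exists_lt_of_lt_csSup hA ht
      exact lt_of_lt_of_le ht' (measure_mono (Ioi_subset_Ioi hlt.le))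
  refine ⟨sSup A, le_antisymm ?_ ?_, hiff⟩
  · rw [← Ioi_union_left]
    exact (measure_union_le _ _).trans (by simpa [hatom] using hle)
  -- Continuity from above needs a finite tail starting strictly below the supremum, which is what
  -- `exists_lt` supplies.
  · obtain ⟨t, hts, ht⟩ := hη.exists_lt _ (ne_top_of_le_ne_top hu hle)
    obtain ⟨n, hn⟩ := exists_nat_one_div_lt (sub_pos.2 hts)
    have := tendsto_measure_iInter_atTop (μ := η)
      (s := fun n : ℕ => Ioi (sSup A - 1 / ((n : ℝ) + 1)))
      (fun n => measurableSet_Ioi.nullMeasurableSet)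
      (fun a b hab => Ioi_subset_Ioi (by gcongr))
      ⟨n, ne_top_of_le_ne_top ht (measure_mono (Ioi_subset_Ioi (by linarith)))⟩
    have hI : ⋂ n : ℕ, Ioi (sSup A - 1 / ((n : ℝ) + 1)) = Ici (sSup A) := by
      ext x
      simp only [mem_iInter, mem_Ioi, mem_Ici]
      refine ⟨fun hx => ?_, fun hx n => lt_of_lt_of_le (sub_lt_self _ (hpos n)) hx⟩
      by_contra! hlt
      obtain ⟨n, hn⟩ := exists_nat_one_div_lt (sub_pos.2 hlt)
      linarith [hx n]
    rw [hI] at this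
    exact ge_of_tendsto' this fun n => ((hiff _).2 (sub_lt_self _ (hpos n))).le

/-- The expected number of points above the largest point of the process is exponentially
distributed. -/
lemma HasMaxTail.measure_lt_iInf (hη : HasMaxTail η) (h0 : η (Ioi 0) = ∞)
    (hatom : ∀ t, η {t} = 0) (h : HasPoissonLaplace V η μ) (hV : ∀ i, Measurable (V i))
    {u : ℝ≥0∞} (hu0 : u ≠ 0) (hu : u ≠ ∞) :
    μ {ω | u < ⨅ k, η (Ioi (V k ω))} = expNeg u := by
  obtain ⟨s, hs, hiff⟩ := hη.exists_quantile h0 hatom hu0 hu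
  rw [← hs, ← h.measure_forall_notMem hV measurableSet_Ici]
  refine measure_congr ?_
  filter_upwards [hη.ae_exists_max h0 h hV] with ω ⟨k, hk⟩
  refine propext ⟨fun hω i => ?_, fun hω => ?_⟩
  · have hω' : η (Ici s) < ⨅ k, η (Ioi (V k ω)) := hω
    rw [hs] at hω'
    exact not_le.2 ((hiff _).1 (lt_of_lt_of_le hω' (iInf_le (fun k => η (Ioi (V k ω))) i)))
  · have : ⨅ k, η (Ioi (V k ω)) = η (Ioi (V k ω)) :=
      le_antisymm (iInf_le _ k) (le_iInf fun i => measure_mono (Ioi_subset_Ioi (hk i)))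
    change η (Ici s) < ⨅ k, η (Ioi (V k ω))
    rw [this, hs, hiff]
    exact not_le.1 (hω k)

lemma measurable_measure_Ioi (η : Measure ℝ) : Measurable fun t => η (Ioi t) :=
  (show Antitone fun t => η (Ioi t) from
    fun _ _ hab => measure_mono (Ioi_subset_Ioi hab)).measurable

end

/-! ### Points above the maximum of an independent process. -/

lemma lintegral_expNeg_of_exponential {Ω : Type*} [MeasurableSpace Ω] {μ : Measure Ω}
    [IsProbabilityMeasure μ] {U : Ω → ℝ≥0∞} (hU : Measurable U)
    (hlaw : ∀ u, u ≠ 0 → u ≠ ∞ → μ {ω | u < U ω} = expNeg u) (c : ℝ≥0) :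
    ∫⁻ ω, expNeg (c * U ω) ∂μ = (1 + c : ℝ≥0∞)⁻¹ := by
  have hfin : ∀ᵐ ω ∂μ, U ω ≠ ∞ := by
    have hz : μ {ω | U ω = ∞} = 0 := by
      refine le_antisymm ?_ zero_le
      have hlim : Tendsto (fun n : ℕ => expNeg ((n + 1 : ℕ) : ℝ≥0∞)) atTop (𝓝 0) := by
        rw [← expNeg_top]
        exact (continuous_expNeg.tendsto _).comp
          (ENNReal.tendsto_nat_nhds_top.comp (tendsto_add_atTop_nat 1))
      refine ge_of_tendsto' hlim fun n => ?_
      rw [← hlaw _ (by simp) (by simp)]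
      refine measure_mono fun ω hω => ?_
      rw [mem_ofPred_eq] at hω ⊢
      rw [hω]
      exact ENNReal.natCast_lt_top _
    exact measure_eq_zero_iff_ae_notMem.1 hz
  -- Layer cake with density `c * exp (-c t)`: the mean of `1 - exp (-c U)` is the integral of `P(U
  -- > t) * c * exp (-c t)`, that is `c / (1 + c)`.
  have hkey := lintegral_comp_eq_lintegral_meas_lt_mul (f := fun ω => (U ω).toReal)
    (g := fun t => c * Real.exp (-(c * t))) μ (ae_of_all _ fun ω => ENNReal.toReal_nonneg)
    hU.ennreal_toReal.aemeasurable
    (fun t _ => Continuous.intervalIntegrable (by fun_prop) _ _)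
    (ae_of_all _ fun t => by positivity)
  have hL : ∀ᵐ ω ∂μ, ENNReal.ofReal (∫ t in 0..(U ω).toReal, c * Real.exp (-(c * t)))
      = 1 - expNeg (c * U ω) := by
    filter_upwards [hfin] with ω hω
    have hint : ∫ t in 0..(U ω).toReal, c * Real.exp (-(c * t))
        = 1 - Real.exp (-(c * (U ω).toReal)) := by
      rw [intervalIntegral.integral_eq_sub_of_hasDerivAt (f := fun t => -Real.exp (-(c * t)))
        (fun t _ => by
          have := (((hasDerivAt_id t).const_mul (c : ℝ)).neg.exp).neg
          convert! this using 1
          simp [mul_comm])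
        (Continuous.intervalIntegrable (by fun_prop) _ _)]
      simp; ring
    have he : (c : ℝ≥0∞) * U ω = ENNReal.ofReal (c * (U ω).toReal) := by
      rw [ENNReal.ofReal_mul c.coe_nonneg, ENNReal.ofReal_toReal hω, ENNReal.ofReal_coe_nnreal]
    rw [hint, he, expNeg_ofReal (by positivity), ENNReal.ofReal_sub _ (Real.exp_pos _).le,
      ENNReal.ofReal_one]
  have hR : ∫⁻ t in Ioi 0, μ {ω | t < (U ω).toReal} * ENNReal.ofReal (c * Real.exp (-(c * t)))
      = ENNReal.ofReal (c / (1 + c)) := by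
    have hneg : -(1 + (c : ℝ)) < 0 := by linarith [c.coe_nonneg]
    have hi := (integrableOn_exp_mul_Ioi hneg 0).const_mul (c : ℝ)
    have hval : ∫ t in Ioi (0 : ℝ), (c : ℝ) * Real.exp (-(1 + c) * t) = c / (1 + c) := by
      rw [integral_const_mul, integral_exp_mul_Ioi hneg]
      rw [mul_zero, Real.exp_zero, neg_div_neg_eq, mul_one_div]
    rw [← hval, ofReal_integral_eq_lintegral_ofReal hi (ae_of_all _ fun t => by positivity)]
    refine setLIntegral_congr_fun measurableSet_Ioi fun t ht => ?_
    have ht' : 0 < t := ht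
    have hset : μ {ω | t < (U ω).toReal} = μ {ω | ENNReal.ofReal t < U ω} := by
      refine measure_congr ?_
      filter_upwards [hfin] with ω hω
      exact propext (ENNReal.ofReal_lt_iff_lt_toReal ht'.le hω).symm
    rw [hset, hlaw _ (by simpa using ht') ENNReal.ofReal_ne_top, expNeg_ofReal ht'.le,
      ← ENNReal.ofReal_mul (Real.exp_pos _).le]
    congr 1
    rw [show -(1 + (c : ℝ)) * t = -t + -(c * t) by ring, Real.exp_add]
    ring
  rw [lintegral_congr_ae hL, hR] at hkey
  have hm : Measurable fun ω => expNeg (c * U ω) :=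
    continuous_expNeg.measurable.comp (hU.const_mul _)
  have hle : ∫⁻ ω, expNeg (c * U ω) ∂μ ≤ 1 :=
    (lintegral_mono fun ω => expNeg_le_one _).trans (by simp)
  rw [lintegral_sub hm (hle.trans_lt ENNReal.one_lt_top).ne (ae_of_all _ fun ω => expNeg_le_one _),
    lintegral_one, measure_univ] at hkey
  rw [← ENNReal.sub_sub_cancel ENNReal.one_ne_top hle, hkey, ← ENNReal.ofReal_one,
    ← ENNReal.ofReal_sub _ (by positivity), show (1 : ℝ) - c / (1 + c) = (1 + (c : ℝ))⁻¹ by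
      have := c.coe_nonneg
      field_simp
      ring,
    ENNReal.ofReal_inv_of_pos (by positivity), ENNReal.ofReal_add zero_le_one c.coe_nonneg]
  simp

/-- Probability generating function of the number of points of a Poisson process with intensity
`a • η` that lie above the largest point of an independent Poisson process with intensity `η`. -/
lemma lintegral_enatPow_count_above {Ω₁ Ω₂ : Type*} [MeasurableSpace Ω₁] [MeasurableSpace Ω₂]
    {μ₁ : Measure Ω₁} {μ₂ : Measure Ω₂} [IsProbabilityMeasure μ₁] [IsProbabilityMeasure μ₂]
    {η : Measure ℝ} (hη : HasMaxTail η) (h0 : η (Ioi 0) = ∞) (hatom : ∀ t, η {t} = 0)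
    {V : ℕ → Ω₁ → ℝ} (hV : ∀ i, Measurable (V i)) (hVP : HasPoissonLaplace V η μ₁)
    {U : ℕ → Ω₂ → ℝ} (hU : ∀ i, Measurable (U i)) {a : ℝ≥0}
    (hUP : HasPoissonLaplace U (a • η) μ₂) {s : ℝ≥0} (hs : s ≤ 1) :
    ∫⁻ p, enatPow s {i | ∀ k, V k p.1 < U i p.2}.encard ∂(μ₁.prod μ₂) =
      (1 + (a * (1 - s) : ℝ≥0) : ℝ≥0∞)⁻¹ := by
  have hmeas : ∀ i, MeasurableSet {p : Ω₁ × Ω₂ | ∀ k, V k p.1 < U i p.2} := fun i => by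
    simp only [ofPred_forall]
    exact MeasurableSet.iInter fun k =>
      measurableSet_lt ((hV k).comp measurable_fst) ((hU i).comp measurable_snd)
  have hm : Measurable fun p : Ω₁ × Ω₂ => enatPow s {i | ∀ k, V k p.1 < U i p.2}.encard :=
    (measurable_from_top (f := enatPow s)).comp (measurable_setOf_encard hmeas)
  have hI : Measurable fun ω => ⨅ k, η (Ioi (V k ω)) :=
    Measurable.iInf fun k => (measurable_measure_Ioi η).comp (hV k)
  rw [lintegral_prod _ hm.aemeasurable, ← lintegral_expNeg_of_exponential hI
    fun u hu0 hu => hη.measure_lt_iInf h0 hatom hVP hV hu0 hu]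
  refine lintegral_congr_ae ?_
  -- Conditionally on the first process, its maximum is a constant and the count is that of a fixed
  -- half-line.
  filter_upwards [hη.ae_exists_max h0 hVP hV] with ω ⟨k, hk⟩
  have hset : {u : ℝ | ∀ k, V k ω < u} = Ioi (V k ω) := by
    ext u
    exact ⟨fun hu => hu k, fun hu k' => (hk k').trans_lt hu⟩
  have hinf : ⨅ k, η (Ioi (V k ω)) = η (Ioi (V k ω)) :=
    le_antisymm (iInf_le _ k) (le_iInf fun i => measure_mono (Ioi_subset_Ioi (hk i)))
  have := hUP.lintegral_enatPow (B := {u : ℝ | ∀ k, V k ω < u}) (hset ▸ measurableSet_Ioi)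
    (c := s) (by exact_mod_cast hs)
  refine this.trans ?_
  rw [hset, hinf]
  congr 1
  rw [Measure.smul_apply, ENNReal.smul_def, smul_eq_mul, ← mul_assoc, ENNReal.coe_mul,
    mul_comm (a : ℝ≥0∞)]
  simp

/-! ### From generating function to geometric law and mean. -/

/-- Letting `s → 0` kills the constant coefficient; dividing by `s` shifts the sequence with the
same bound. The sequence is quantified after `n` so that the induction applies to the shift. -/
lemma eq_zero_of_powerSeries_eq_zero (C : ℝ) (n : ℕ) : ∀ d : ℕ → ℝ, (∀ n, |d n| ≤ C) →
    (∀ s : ℝ, 0 < s → s < 1 → ∑' n, d n * s ^ n = 0) → d n = 0 := by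
  have hsum : ∀ d : ℕ → ℝ, (∀ n, |d n| ≤ C) → ∀ s : ℝ, 0 < s → s < 1 →
      Summable fun n => d n * s ^ n := fun d hd s hs0 hs1 =>
    Summable.of_norm_bounded ((summable_geometric_of_lt_one hs0.le hs1).mul_left C) fun n => by
      rw [norm_mul, Real.norm_eq_abs, norm_pow, Real.norm_of_nonneg hs0.le]
      exact mul_le_mul_of_nonneg_right (hd n) (by positivity)
  have hstep : ∀ d : ℕ → ℝ, (∀ n, |d n| ≤ C) → ∀ s : ℝ, 0 < s → s < 1 →
      ∑' n, d n * s ^ n = d 0 + s * ∑' n, d (n + 1) * s ^ n := fun d hd s hs0 hs1 => by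
    rw [(hsum d hd s hs0 hs1).tsum_eq_zero_add, ← tsum_mul_left]
    congr 1
    · simp
    · exact tsum_congr fun n => by ring
  have hzero : ∀ d : ℕ → ℝ, (∀ n, |d n| ≤ C) →
      (∀ s : ℝ, 0 < s → s < 1 → ∑' n, d n * s ^ n = 0) → d 0 = 0 := by
    intro d hd h
    have hbound : ∀ s : ℝ, 0 < s → s < 1 → |d 0| ≤ s * (C * (1 - s)⁻¹) := by
      intro s hs0 hs1
      have h1 := hstep d hd s hs0 hs1
      rw [h s hs0 hs1] at h1
      have h2 : d 0 = -(s * ∑' n, d (n + 1) * s ^ n) := by linarith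
      rw [h2, abs_neg, abs_mul, abs_of_pos hs0]
      refine mul_le_mul_of_nonneg_left ?_ hs0.le
      refine (Real.norm_eq_abs _).symm.trans_le (tsum_of_norm_bounded
        ((hasSum_geometric_of_lt_one hs0.le hs1).mul_left C) fun n => ?_)
      rw [norm_mul, Real.norm_eq_abs, norm_pow, Real.norm_of_nonneg hs0.le]
      exact mul_le_mul_of_nonneg_right (hd _) (by positivity)
    have hlim : Tendsto (fun s : ℝ => s * (C * (1 - s)⁻¹)) (𝓝[>] 0) (𝓝 0) := by
      have : ContinuousAt (fun s : ℝ => s * (C * (1 - s)⁻¹)) 0 := by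
        refine continuousAt_id.mul (continuousAt_const.mul (ContinuousAt.inv₀ ?_ (by simp)))
        fun_prop
      simpa using this.tendsto.mono_left nhdsWithin_le_nhds
    have : |d 0| ≤ 0 := by
      refine ge_of_tendsto hlim ?_
      filter_upwards [Ioo_mem_nhdsGT (zero_lt_one' ℝ)] with s hs
      exact hbound s hs.1 hs.2
    exact abs_nonpos_iff.1 this
  induction n with
  | zero => exact hzero
  | succ n ih =>
    intro d hd h
    refine ih (fun n => d (n + 1)) (fun n => hd _) fun s hs0 hs1 => ?_
    have h1 := hstep d hd s hs0 hs1
    rw [h s hs0 hs1, hzero d hd h, zero_add] at h1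
    exact (mul_eq_zero.1 h1.symm).resolve_left hs0.ne'

lemma lintegral_enat_eq {Ω : Type*} [MeasurableSpace Ω] {μ : Measure Ω} {N : Ω → ℕ∞}
    (hN : Measurable N) (f : ℕ∞ → ℝ≥0∞) :
    ∫⁻ ω, f (N ω) ∂μ = f ⊤ * μ {ω | N ω = ⊤} + ∑' n : ℕ, f n * μ {ω | N ω = n} := by
  have hmap : ∀ k, (μ.map N) {k} = μ {ω | N ω = k} := fun k =>
    Measure.map_apply hN (measurableSet_singleton k)
  have hinj : Function.Injective ((↑) : ℕ → ℕ∞) := Nat.cast_injective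
  rw [← lintegral_map (f := f) measurable_from_top hN, lintegral_countable']
  simp_rw [hmap]
  rw [ENNReal.tsum_eq_add_tsum_ite (⊤ : ℕ∞)]
  congr 1
  rw [← hinj.tsum_eq]
  · exact tsum_congr fun n => if_neg (ENat.natCast_ne_top n)
  · intro k hk
    have hk' : k ≠ ⊤ := fun h => hk (if_pos h)
    exact ENat.ne_top_iff_exists.1 hk'

section

variable {Ω : Type*} [MeasurableSpace Ω] {μ : Measure Ω} [IsProbabilityMeasure μ] {N : Ω → ℕ∞}

/-- The geometric law is determined by its probability generating function. -/
lemma measureReal_eq_geometric (hN : Measurable N) (a : ℝ≥0)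
    (h : ∀ s : ℝ≥0, s < 1 → ∫⁻ ω, enatPow s (N ω) ∂μ = (1 + (a * (1 - s) : ℝ≥0) : ℝ≥0∞)⁻¹)
    (n : ℕ) : μ.real {ω | N ω = n} = (a / (1 + a) : ℝ) ^ n * (1 / (1 + a)) := by
  set q : ℝ := a / (1 + a) with hq
  have hq0 : 0 ≤ q := by positivity
  have hq1 : q < 1 := by
    rw [hq, div_lt_one (by positivity)]; simp
  have hp : (1 : ℝ) / (1 + a) = 1 - q := by
    rw [hq]; field_simp; ring
  have key := eq_zero_of_powerSeries_eq_zero 1 n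
    (fun n => μ.real {ω | N ω = n} - q ^ n * (1 - q)) (fun n => ?_) fun s hs0 hs1 => ?_
  · rw [hp]; linarith
  · rw [abs_sub_le_iff]
    have h1 : μ.real {ω | N ω = n} ≤ 1 := measureReal_le_one
    have h2 : 0 ≤ μ.real {ω | N ω = n} := measureReal_nonneg
    have h3 : q ^ n * (1 - q) ≤ 1 :=
      mul_le_one₀ (pow_le_one₀ hq0 hq1.le) (by linarith) (by linarith)
    have h4 : 0 ≤ q ^ n * (1 - q) := mul_nonneg (pow_nonneg hq0 _) (by linarith)
    constructor <;> linarith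
  · lift s to ℝ≥0 using hs0.le
    have hs1' : s < 1 := by exact_mod_cast hs1
    have h1 := h s hs1'
    -- For `s < 1` the value `⊤` contributes nothing, so an ordinary power series remains.
    rw [lintegral_enat_eq hN, enatPow_top (by exact_mod_cast hs1'), zero_mul, zero_add] at h1
    have h2 := congrArg ENNReal.toReal h1
    rw [ENNReal.tsum_toReal_eq fun n => by
      rw [enatPow_coe (by exact_mod_cast hs1'.le)]; finiteness] at h2
    simp_rw [enatPow_coe (c := (s : ℝ≥0∞)) (by exact_mod_cast hs1'.le)] at h2
    have hR : ((1 + (a * (1 - s) : ℝ≥0) : ℝ≥0∞)⁻¹).toReal = (1 + (a : ℝ) * (1 - s))⁻¹ := by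
      rw [← ENNReal.coe_one, ← ENNReal.coe_add, ENNReal.toReal_inv, ENNReal.coe_toReal,
        NNReal.coe_add, NNReal.coe_mul, NNReal.coe_sub hs1'.le, NNReal.coe_one]
    rw [hR] at h2
    have hsA : Summable fun n : ℕ => μ.real {ω | N ω = n} * (s : ℝ) ^ n :=
      Summable.of_nonneg_of_le (fun n => by positivity)
        (fun n => mul_le_of_le_one_left (by positivity) measureReal_le_one)
        (summable_geometric_of_lt_one hs0.le hs1)
    have hqs : q * s < 1 := mul_lt_one_of_nonneg_of_lt_one_left hq0 hq1 hs1.le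
    have hB := (hasSum_geometric_of_lt_one (mul_nonneg hq0 hs0.le) hqs).mul_left (1 - q)
    have hB' : HasSum (fun n : ℕ => q ^ n * (1 - q) * (s : ℝ) ^ n) ((1 - q) * (1 - q * s)⁻¹) := by
      convert! hB using 1
      ext n; rw [mul_pow]; ring
    have hA : ∑' n : ℕ, μ.real {ω | N ω = n} * (s : ℝ) ^ n = (1 + (a : ℝ) * (1 - s))⁻¹ := by
      rw [← h2]
      refine tsum_congr fun n => ?_
      simp [Measure.real, mul_comm]
    simp_rw [sub_mul]
    rw [hsA.tsum_sub hB'.summable, hA, hB'.tsum_eq, ← hp, hq]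
    have ha := a.coe_nonneg
    have hsn := s.coe_nonneg
    have h5 : (0 : ℝ) < 1 + a * (1 - s) := by
      have := mul_nonneg ha (sub_nonneg.2 hs1.le)
      linarith
    have h6 : (1 : ℝ) - a / (1 + a) * s = (1 + a * (1 - s)) / (1 + a) := by
      field_simp; ring
    rw [h6, inv_div]
    field_simp
    ring

lemma lintegral_of_geometric (hN : Measurable N) (a : ℝ≥0)
    (h : ∀ n : ℕ, μ.real {ω | N ω = n} = (a / (1 + a) : ℝ) ^ n * (1 / (1 + a))) :
    ∫⁻ ω, (N ω : ℝ≥0∞) ∂μ = a := by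
  set q : ℝ := a / (1 + a) with hq
  have hq0 : 0 ≤ q := by positivity
  have hq1 : q < 1 := by
    rw [hq, div_lt_one (by positivity)]; simp
  have hp : (1 : ℝ) / (1 + a) = 1 - q := by
    rw [hq]; field_simp; ring
  have hN' : ∀ n : ℕ, μ {ω | N ω = n} = ENNReal.ofReal (q ^ n * (1 - q)) := fun n => by
    rw [← hp, ← h n, ofReal_measureReal]
  have h4 : ∀ n : ℕ, 0 ≤ q ^ n * (1 - q) := fun n => mul_nonneg (pow_nonneg hq0 _) (by linarith)
  have hone : ∑' n : ℕ, μ {ω | N ω = n} = 1 := by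
    simp_rw [hN']
    have := (hasSum_geometric_of_lt_one hq0 hq1).mul_right (1 - q)
    rw [inv_mul_cancel₀ (by linarith)] at this
    rw [← ENNReal.ofReal_tsum_of_nonneg h4 this.summable, this.tsum_eq, ENNReal.ofReal_one]
  -- The geometric weights have total mass one, which leaves none for `⊤`.
  have htop : μ {ω | N ω = ⊤} = 0 := by
    have := lintegral_enat_eq (μ := μ) hN (fun _ => 1)
    simp only [lintegral_one, measure_univ, one_mul, hone] at this
    exact (ENNReal.add_left_inj ENNReal.one_ne_top).1 (by rw [zero_add, ← this])
  rw [lintegral_enat_eq hN (fun k => (k : ℝ≥0∞)), htop, mul_zero, zero_add]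
  have hs := (hasSum_coe_mul_geometric_of_norm_lt_one
    (by rwa [Real.norm_of_nonneg hq0] : ‖q‖ < 1)).mul_right (1 - q)
  have hterm : ∀ n : ℕ, ((n : ℕ∞) : ℝ≥0∞) * μ {ω | N ω = n}
      = ENNReal.ofReal (n * q ^ n * (1 - q)) := fun n => by
    rw [hN', mul_assoc, ENNReal.ofReal_mul (p := (n : ℝ)) (by positivity)]
    simp
  simp_rw [hterm]
  rw [← ENNReal.ofReal_tsum_of_nonneg (fun n => by rw [mul_assoc]; exact mul_nonneg (by positivity) (h4 n))
    hs.summable, hs.tsum_eq, ← ENNReal.ofReal_coe_nnreal]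
  congr 1
  have h1q : (1 - q) ≠ 0 := by linarith
  rw [← hp, hq]
  have ha := a.coe_nonneg
  field_simp

end

/-! ### Regrouping independent families. -/

section Independence

lemma comap_pi_comp {Ω α ι S : Type*} [MeasurableSpace S] (ζ : ι → Ω → S) (a : α → ι) :
    MeasurableSpace.comap (fun ω i => ζ (a i) ω) MeasurableSpace.pi
      = ⨆ i ∈ range a, MeasurableSpace.comap (ζ i) inferInstance := by
  simp_rw [MeasurableSpace.pi, MeasurableSpace.comap_iSup, MeasurableSpace.comap_comp, iSup_range]
  rfl

variable {Ω : Type*} [MeasurableSpace Ω] {μ : Measure Ω}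

lemma map_prod_prod_comm [IsProbabilityMeasure μ] {α β γ δ : Type*} [MeasurableSpace α]
    [MeasurableSpace β] [MeasurableSpace γ] [MeasurableSpace δ] {A : Ω → α} {B : Ω → β}
    {C : Ω → γ} {D : Ω → δ} (hA : Measurable A) (hB : Measurable B) (hC : Measurable C)
    (hD : Measurable D) (hAB : IndepFun A B μ) (hCD : IndepFun C D μ)
    (h : IndepFun (fun ω => (A ω, B ω)) (fun ω => (C ω, D ω)) μ) :
    μ.map (fun ω => ((A ω, C ω), (B ω, D ω))) =
      ((μ.map A).prod (μ.map C)).prod ((μ.map B).prod (μ.map D)) := by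
  have := Measure.isProbabilityMeasure_map (μ := μ) hA.aemeasurable
  have := Measure.isProbabilityMeasure_map (μ := μ) hB.aemeasurable
  have := Measure.isProbabilityMeasure_map (μ := μ) hC.aemeasurable
  have := Measure.isProbabilityMeasure_map (μ := μ) hD.aemeasurable
  have h1 := h.map_prod_eq_prod_map_map (hA.prodMk hB).aemeasurable (hC.prodMk hD).aemeasurable
  rw [hAB.map_prod_eq_prod_map_map hA.aemeasurable hB.aemeasurable,
    hCD.map_prod_eq_prod_map_map hC.aemeasurable hD.aemeasurable] at h1
  have m1 := measurePreserving_prodAssoc (μ.map A) (μ.map B) ((μ.map C).prod (μ.map D))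
  have m2 := (measurePreserving_prodAssoc (μ.map B) (μ.map C) (μ.map D)).symm
  have m3 := (Measure.measurePreserving_swap (μ := μ.map B) (ν := μ.map C)).prod
    (MeasurePreserving.id (μ.map D))
  have m4 := measurePreserving_prodAssoc (μ.map C) (μ.map B) (μ.map D)
  have m5 := (MeasurePreserving.id (μ.map A)).prod (m4.comp (m3.comp m2))
  have m6 := (measurePreserving_prodAssoc (μ.map A) (μ.map C) ((μ.map B).prod (μ.map D))).symm
  have m := m6.comp (m5.comp m1)
  rw [← m.map_eq, ← h1, Measure.map_map m.measurable ((hA.prodMk hB).prodMk (hC.prodMk hD))]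
  rfl

lemma indepFun_of_disjoint_range {α β ι S : Type*} [MeasurableSpace S] {ζ : ι → Ω → S}
    (h : iIndepFun ζ μ) (hζ : ∀ i, Measurable (ζ i)) {a : α → ι} {b : β → ι}
    (hab : Disjoint (range a) (range b)) :
    IndepFun (fun ω i => ζ (a i) ω) (fun ω j => ζ (b j) ω) μ := by
  rw [IndepFun_iff_Indep, comap_pi_comp ζ a, comap_pi_comp ζ b]
  exact indep_iSup_of_disjoint (fun i => (hζ i).comap_le) h hab

end Independence

/-! ### The intensity measure of received powers. -/

section Power

variable {P : ℝ} {g : ℝ → ℝ → ℝ}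

lemma measurable_rxPower (P : ℝ) (hg_meas : Measurable (Function.uncurry g)) {α : Type*}
    [MeasurableSpace α] {p q : α → Plane} {z : α → ℝ} (hp : Measurable p) (hq : Measurable q)
    (hz : Measurable z) : Measurable fun a => rxPower P g (p a) (q a) (z a) :=
  (hg_meas.comp ((hp.dist hq).prodMk hz)).const_mul P

/-- The distribution of received powers from the nodes of a planar process with unit density. -/
noncomputable def powerMeasure (P : ℝ) (g : ℝ → ℝ → ℝ) (ν : Measure ℝ) : Measure ℝ :=
  (volume.prod ν).map fun p : Plane × ℝ => rxPower P g 0 p.1 p.2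

variable {ν : Measure ℝ} [IsProbabilityMeasure ν]

/-- Translation invariance of area makes the intensity independent of the observing point; the
in-degree argument rests on this. -/
lemma map_rxPower_eq_powerMeasure (hg_meas : Measurable (Function.uncurry g)) (x : Plane) :
    (volume.prod ν).map (fun p : Plane × ℝ => rxPower P g x p.1 p.2) = powerMeasure P g ν := by
  have m := (measurePreserving_sub_right (volume : Measure Plane) x).prod (MeasurePreserving.id ν)
  rw [powerMeasure]
  conv_rhs => rw [← m.map_eq, Measure.map_map
    (measurable_rxPower P hg_meas measurable_const measurable_fst measurable_snd) m.measurable]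
  congr 1
  ext p
  simp [rxPower, dist_eq_norm, norm_sub_rev]

lemma ae_dist_ne_zero (ν : Measure ℝ) [IsProbabilityMeasure ν] :
    ∀ᵐ p : Plane × ℝ ∂(volume.prod ν), 0 < dist 0 p.1 := by
  have : ∀ᵐ x : Plane, x ≠ 0 := by simp [ae_iff]
  have h2 := Measure.quasiMeasurePreserving_fst (μ := (volume : Measure Plane)) (ν := ν) |>.ae this
  filter_upwards [h2] with p hp
  exact dist_pos.2 (Ne.symm hp)

lemma IsPathGain.pos {h : ℝ → ℝ} (hh : IsPathGain h) {r : ℝ} (hr : 0 < r) : 0 < h r := by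
  have h1 : h (r + 1) < h r := hh.strictAntiOn hr (by simp; linarith) (by linarith)
  refine (le_of_tendsto hh.tendsto_zero ?_).trans_lt h1
  filter_upwards [eventually_ge_atTop (r + 1)] with t ht
  exact hh.strictAntiOn.antitoneOn (by simp; linarith) (by simp; linarith) ht

lemma ae_rxPower_pos (hP : 0 < P) (hg : ∀ᵐ z ∂ν, IsPathGain fun r => g r z) :
    ∀ᵐ p : Plane × ℝ ∂(volume.prod ν), 0 < rxPower P g 0 p.1 p.2 := by
  have h2 := Measure.quasiMeasurePreserving_snd (μ := (volume : Measure Plane)) (ν := ν) |>.ae hg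
  filter_upwards [ae_dist_ne_zero ν, h2] with p hp hz
  exact mul_pos hP (hz.pos hp)

lemma powerMeasure_Iic_zero (hg_meas : Measurable (Function.uncurry g)) (hP : 0 < P)
    (hg : ∀ᵐ z ∂ν, IsPathGain fun r => g r z) : powerMeasure P g ν (Iic 0) = 0 := by
  rw [powerMeasure, Measure.map_apply
    (measurable_rxPower P hg_meas measurable_const measurable_fst measurable_snd) measurableSet_Iic]
  refine measure_eq_zero_iff_ae_notMem.2 ?_
  filter_upwards [ae_rxPower_pos hP hg] with p hp
  simpa using hp

lemma powerMeasure_Ioi_zero (hg_meas : Measurable (Function.uncurry g)) (hP : 0 < P)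
    (hg : ∀ᵐ z ∂ν, IsPathGain fun r => g r z) : powerMeasure P g ν (Ioi 0) = ∞ := by
  have huniv : powerMeasure P g ν univ = ∞ := by
    rw [powerMeasure, Measure.map_apply
      (measurable_rxPower P hg_meas measurable_const measurable_fst measurable_snd) MeasurableSet.univ,
      preimage_univ, ← univ_prod_univ, Measure.prod_prod, measure_univ (μ := ν), mul_one]
    exact measure_univ_of_isAddLeftInvariant _
  have h := measure_union_le (μ := powerMeasure P g ν) (Iic 0) (Ioi 0)
  rw [Iic_union_Ioi, huniv, powerMeasure_Iic_zero hg_meas hP hg, zero_add] at h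
  exact top_le_iff.1 h

/-- For fixed `z`, strict monotonicity allows at most one distance with power `t`, so the fibre lies
in a circle together with the origin, where the gain is unconstrained. Both are null, whatever atoms
`ν` has. -/
lemma powerMeasure_singleton (hg_meas : Measurable (Function.uncurry g)) (hP : 0 < P)
    (hg : ∀ᵐ z ∂ν, IsPathGain fun r => g r z) (t : ℝ) : powerMeasure P g ν {t} = 0 := by
  have hm : Measurable fun p : Plane × ℝ => rxPower P g 0 p.1 p.2 :=
    measurable_rxPower P hg_meas measurable_const measurable_fst measurable_snd
  rw [powerMeasure, Measure.map_apply hm (measurableSet_singleton t),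
    Measure.prod_apply_symm (hm (measurableSet_singleton t))]
  refine (lintegral_congr_ae ?_).trans lintegral_zero
  filter_upwards [hg] with z hz
  by_cases hex : ∃ r > 0, P * g r z = t
  · obtain ⟨r, hr, hrt⟩ := hex
    have hsub : (fun x : Plane => (x, z)) ⁻¹' ((fun p : Plane × ℝ => rxPower P g 0 p.1 p.2) ⁻¹' {t})
        ⊆ {0} ∪ Metric.sphere 0 r := by
      intro x hx
      by_cases hx0 : x = 0
      · exact Or.inl hx0
      · right
        have hx' : P * g (dist 0 x) z = t := hx
        have := hz.strictAntiOn.injOn (dist_pos.2 (Ne.symm hx0)) hr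
          (mul_left_cancel₀ hP.ne' (hx'.trans hrt.symm))
        rwa [Metric.mem_sphere, dist_comm]
    refine measure_mono_null hsub (measure_union_null (by simp) ?_)
    exact Measure.addHaar_sphere _ _ _
  · refine measure_mono_null (t := {0}) (fun x hx => ?_) (by simp)
    by_contra hx0
    exact hex ⟨dist 0 x, dist_pos.2 (Ne.symm hx0), hx⟩

/-- Received power from the `i`-th node of a marked configuration `w` at the point `x`. -/
noncomputable def markedPower (P : ℝ) (g : ℝ → ℝ → ℝ) (x : Plane) (i : ℕ)
    (w : (ℕ → Plane) × (ℕ → ℝ)) : ℝ := rxPower P g x (w.1 i) (w.2 i)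

lemma measurable_markedPower (hg_meas : Measurable (Function.uncurry g)) (x : Plane) (i : ℕ) :
    Measurable (markedPower P g x i) :=
  measurable_rxPower P hg_meas measurable_const ((measurable_pi_apply i).comp measurable_fst)
    ((measurable_pi_apply i).comp measurable_snd)

/-- The law of the random points `X` with i.i.d. marks of law `ν`. -/
noncomputable def markedLaw {Ω : Type*} [MeasurableSpace Ω] (X : ℕ → Ω → Plane) (μ : Measure Ω)
    (ν : Measure ℝ) [IsProbabilityMeasure ν] : Measure ((ℕ → Plane) × (ℕ → ℝ)) :=
  (μ.map fun ω i => X i ω).prod (Measure.infinitePi fun _ => ν)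

lemma IsPoissonProcess.hasPoissonLaplace_markedPower {Ω : Type*} [MeasurableSpace Ω]
    {μ : Measure Ω} [IsProbabilityMeasure μ] {lam : ℝ≥0} {X : ℕ → Ω → Plane}
    (h : IsPoissonProcess lam X μ) (hg_meas : Measurable (Function.uncurry g)) (x : Plane) :
    HasPoissonLaplace (markedPower P g x) (lam • powerMeasure P g ν) (markedLaw X μ ν) := by
  have hX : Measurable fun ω i => X i ω := measurable_pi_lambda _ h.measurable
  have := Measure.isProbabilityMeasure_map (μ := μ) hX.aemeasurable
  have h1 : HasPoissonLaplace (fun i (w : ℕ → Plane) => w i) (lam • volume)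
      (μ.map fun ω i => X i ω) :=
    (hasPoissonLaplace_map_iff hX measurable_pi_apply).2 h.hasPoissonLaplace
  have h2 := (h1.prod_marks measurable_pi_apply ν).map
    (measurable_rxPower P hg_meas (measurable_const (a := x)) measurable_fst measurable_snd)
  rw [Measure.prod_smul_left, Measure.map_smul, map_rxPower_eq_powerMeasure hg_meas] at h2
  exact h2

end Power

/-! ### Links, marked configurations and their joint law. -/

lemma zero_lt_maxSecrecyRate_iff {s pl pe : ℝ} (hs : 0 < s) (hl : 0 < pl) (he : 0 < pe) :
    0 < maxSecrecyRate s s pl pe ↔ pe < pl := by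
  rw [maxSecrecyRate, lt_max_iff, or_iff_left (lt_irrefl 0), sub_pos,
    Real.logb_lt_logb_iff one_lt_two (by positivity) (by positivity), add_lt_add_iff_left,
    div_lt_div_iff_of_pos_right hs]

lemma lintegral_encard {Ω ι : Type*} [MeasurableSpace Ω] {μ : Measure Ω} [Countable ι]
    {p : ι → Ω → Prop} (hp : ∀ i, MeasurableSet {ω | p i ω}) :
    ∫⁻ ω, ({i | p i ω}.encard : ℝ≥0∞) ∂μ = ∑' i, μ {ω | p i ω} := by
  have h : ∀ ω, ({i | p i ω}.encard : ℝ≥0∞) = ∑' i, {ω | p i ω}.indicator 1 ω := fun ω => by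
    rw [← ENNReal.tsum_set_one, tsum_subtype {i | p i ω} (fun _ => (1 : ℝ≥0∞))]
    refine tsum_congr fun i => ?_
    by_cases hi : p i ω <;> simp [indicator, hi]
  simp_rw [h]
  rw [lintegral_tsum fun i => (measurable_one.indicator (hp i)).aemeasurable]
  exact tsum_congr fun i => lintegral_indicator_one (hp i)

/-- The link between the typical node and the `i`-th legitimate node. -/
def legitLink (i : ℕ) : Link := ⟨s(Sum.inl none, Sum.inl (some i)), by simp⟩

/-- The link between the legitimate node `u` and the `k`-th eavesdropper. -/
def eveLink (u : Option ℕ) (k : ℕ) : Link := ⟨s(Sum.inl u, Sum.inr k), by simp⟩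

lemma legitLink_injective : Function.Injective legitLink := fun i j h => by
  simpa [legitLink] using h

lemma eveLink_injective (u : Option ℕ) : Function.Injective (eveLink u) := fun i j h => by
  simpa [eveLink] using h

lemma disjoint_range_legitLink_eveLink (u : Option ℕ) :
    Disjoint (range legitLink) (range (eveLink u)) := by
  refine disjoint_left.2 ?_
  rintro _ ⟨i, rfl⟩ ⟨k, hk⟩
  simp [legitLink, eveLink] at hk

section Network

variable {Ω : Type*} [MeasurableSpace Ω] {μ : Measure Ω}
  {lamL lamE : ℝ≥0} {P s : ℝ} {ν : Measure ℝ} {g : ℝ → ℝ → ℝ} {X Y : ℕ → Ω → Plane}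
  {Z : Sym2 (Option ℕ ⊕ ℕ) → Ω → ℝ}

/-- The legitimate nodes together with the effects of their links to the typical node. -/
def legitMarked (X : ℕ → Ω → Plane) (Z : Sym2 (Option ℕ ⊕ ℕ) → Ω → ℝ) (ω : Ω) :
    (ℕ → Plane) × (ℕ → ℝ) := (fun i => X i ω, fun i => Z (legitLink i) ω)

/-- The eavesdroppers together with the effects of their links to the legitimate node `u`. -/
def eveMarked (Y : ℕ → Ω → Plane) (Z : Sym2 (Option ℕ ⊕ ℕ) → Ω → ℝ) (u : Option ℕ) (ω : Ω) :
    (ℕ → Plane) × (ℕ → ℝ) := (fun k => Y k ω, fun k => Z (eveLink u k) ω)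

lemma IsPoissonNetwork.measurable_legitMarked (hnet : IsPoissonNetwork lamL lamE ν X Y Z μ) :
    Measurable (legitMarked X Z) :=
  (measurable_pi_lambda _ hnet.legit_poisson.measurable).prodMk
    (measurable_pi_lambda _ fun _ => hnet.measurable_effect _)

lemma IsPoissonNetwork.measurable_eveMarked (hnet : IsPoissonNetwork lamL lamE ν X Y Z μ)
    (u : Option ℕ) : Measurable (eveMarked Y Z u) :=
  (measurable_pi_lambda _ hnet.eve_poisson.measurable).prodMk
    (measurable_pi_lambda _ fun _ => hnet.measurable_effect _)

lemma IsPoissonNetwork.measurable_withOrigin (hnet : IsPoissonNetwork lamL lamE ν X Y Z μ)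
    (u : Option ℕ) : Measurable fun ω => withOrigin X ω u := by
  cases u with
  | none => exact measurable_const
  | some i => exact hnet.legit_poisson.measurable i

lemma IsPoissonNetwork.map_effects (hnet : IsPoissonNetwork lamL lamE ν X Y Z μ) {a : ℕ → Link}
    (ha : Function.Injective a) :
    μ.map (fun ω i => Z (a i) ω) = Measure.infinitePi fun _ => ν := by
  have h := (hnet.effect_indep.precomp ha).map_fun_eq_infinitePi_map
    fun i => hnet.measurable_effect (a i)
  simp only [hnet.effect_law] at h
  exact h

section Law

variable [IsProbabilityMeasure μ] [IsProbabilityMeasure ν]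

/-- The legitimate marks always belong to links at the origin, the eavesdropper marks to links at
`u`. These links are distinct for every `u`, so the product form also holds when `u` is itself a
random legitimate node. -/
lemma IsPoissonNetwork.map_legitMarked_eveMarked (hnet : IsPoissonNetwork lamL lamE ν X Y Z μ)
    (u : Option ℕ) : μ.map (fun ω => (legitMarked X Z ω, eveMarked Y Z u ω)) =
      (markedLaw X μ ν).prod (markedLaw Y μ ν) := by
  have hX : Measurable fun ω i => X i ω := measurable_pi_lambda _ hnet.legit_poisson.measurable
  have hY : Measurable fun ω i => Y i ω := measurable_pi_lambda _ hnet.eve_poisson.measurable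
  have hZ : ∀ a : ℕ → Link, Measurable fun ω i => Z (a i) ω := fun a =>
    measurable_pi_lambda _ fun i => hnet.measurable_effect (a i)
  have hind := hnet.positions_effects_indep.comp measurable_id
    (show Measurable fun z : Link → ℝ => ((fun i => z (legitLink i)), fun k => z (eveLink u k)) from
      (measurable_pi_lambda _ fun i => measurable_pi_apply _).prodMk
        (measurable_pi_lambda _ fun i => measurable_pi_apply _))
  have h := map_prod_prod_comm hX hY (hZ legitLink) (hZ (eveLink u)) hnet.positions_indep
    (indepFun_of_disjoint_range hnet.effect_indep hnet.measurable_effect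
      (disjoint_range_legitLink_eveLink u)) hind
  rw [hnet.map_effects legitLink_injective, hnet.map_effects (eveLink_injective u)] at h
  exact h

instance [IsProbabilityMeasure (μ.map fun ω i => X i ω)] :
    IsProbabilityMeasure (markedLaw X μ ν) := by
  unfold markedLaw; infer_instance

lemma IsPoissonProcess.isProbabilityMeasure_markedLaw {lam : ℝ≥0} (h : IsPoissonProcess lam X μ) :
    IsProbabilityMeasure (markedLaw X μ ν) := by
  have := Measure.isProbabilityMeasure_map (μ := μ)
    (measurable_pi_lambda (fun ω i => X i ω) h.measurable).aemeasurable
  infer_instance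

lemma IsPoissonNetwork.map_legitMarked (hnet : IsPoissonNetwork lamL lamE ν X Y Z μ) :
    μ.map (legitMarked X Z) = markedLaw X μ ν := by
  have := hnet.eve_poisson.isProbabilityMeasure_markedLaw (ν := ν)
  have h := congrArg Measure.fst (hnet.map_legitMarked_eveMarked none)
  rwa [Measure.fst_map_prodMk (hnet.measurable_eveMarked none), Measure.fst_prod] at h

lemma IsPoissonNetwork.map_eveMarked (hnet : IsPoissonNetwork lamL lamE ν X Y Z μ)
    (u : Option ℕ) : μ.map (eveMarked Y Z u) = markedLaw Y μ ν := by
  have := hnet.legit_poisson.isProbabilityMeasure_markedLaw (ν := ν)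
  have := hnet.eve_poisson.isProbabilityMeasure_markedLaw (ν := ν)
  have h := congrArg Measure.snd (hnet.map_legitMarked_eveMarked u)
  rwa [Measure.snd_map_prodMk hnet.measurable_legitMarked, Measure.snd_prod] at h

end Law

lemma IsPoissonNetwork.measurableSet_adj (hnet : IsPoissonNetwork lamL lamE ν X Y Z μ)
    (hg_meas : Measurable (Function.uncurry g)) (u v : Option ℕ) :
    MeasurableSet {ω | (poissonISGraph P s g X Y Z ω).Adj u v} := by
  by_cases huv : u = v
  · have : {ω | (poissonISGraph P s g X Y Z ω).Adj u v} = ∅ :=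
      eq_empty_iff_forall_notMem.2 fun ω hω => hω.1 huv
    rw [this]
    exact MeasurableSet.empty
  have hE : ∀ k, Measurable fun ω =>
      rxPower P g (withOrigin X ω u) (Y k ω) (Z s(Sum.inl u, Sum.inr k) ω) := fun k =>
    measurable_rxPower P hg_meas (hnet.measurable_withOrigin u) (hnet.eve_poisson.measurable k)
      (hnet.measurable_effect (eveLink u k))
  have hL : Measurable fun ω =>
      rxPower P g (withOrigin X ω u) (withOrigin X ω v) (Z s(Sum.inl u, Sum.inl v) ω) :=
    measurable_rxPower P hg_meas (hnet.measurable_withOrigin u) (hnet.measurable_withOrigin v)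
      (hnet.measurable_effect ⟨s(Sum.inl u, Sum.inl v), by simpa using huv⟩)
  have hset : {ω | (poissonISGraph P s g X Y Z ω).Adj u v} = ⋃ k,
      (⋂ k', {ω | rxPower P g (withOrigin X ω u) (Y k' ω) (Z s(Sum.inl u, Sum.inr k') ω)
        ≤ rxPower P g (withOrigin X ω u) (Y k ω) (Z s(Sum.inl u, Sum.inr k) ω)}) ∩
      {ω | 0 < maxSecrecyRate s s
        (rxPower P g (withOrigin X ω u) (withOrigin X ω v) (Z s(Sum.inl u, Sum.inl v) ω))
        (rxPower P g (withOrigin X ω u) (Y k ω) (Z s(Sum.inl u, Sum.inr k) ω))} := by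
    ext ω
    simp only [mem_iUnion, mem_inter_iff, mem_iInter]
    exact and_iff_right huv
  rw [hset]
  refine MeasurableSet.iUnion fun k => (MeasurableSet.iInter fun k' =>
    measurableSet_le (hE k') (hE k)).inter (measurableSet_lt measurable_const ?_)
  unfold maxSecrecyRate Real.logb
  fun_prop

end Network

/-- Positive powers keep the logarithms monotone, and a strongest eavesdropper exists, so beating it
is the same as beating all of them. -/
lemma poissonISGraph_adj_iff {Ω : Type*} {P s : ℝ} {g : ℝ → ℝ → ℝ}
    {X Y : ℕ → Ω → Plane} {Z : Sym2 (Option ℕ ⊕ ℕ) → Ω → ℝ} {ω : Ω} {u v : Option ℕ} (hs : 0 < s) (huv : u ≠ v)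
    (hl : 0 < rxPower P g (withOrigin X ω u) (withOrigin X ω v) (Z s(Sum.inl u, Sum.inl v) ω))
    (he : ∀ k, 0 < markedPower P g (withOrigin X ω u) k (eveMarked Y Z u ω))
    (hmax : ∃ k, ∀ k', markedPower P g (withOrigin X ω u) k' (eveMarked Y Z u ω)
      ≤ markedPower P g (withOrigin X ω u) k (eveMarked Y Z u ω)) :
    (poissonISGraph P s g X Y Z ω).Adj u v ↔
      ∀ k, markedPower P g (withOrigin X ω u) k (eveMarked Y Z u ω) <
        rxPower P g (withOrigin X ω u) (withOrigin X ω v) (Z s(Sum.inl u, Sum.inl v) ω) := by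
  constructor
  · rintro ⟨-, k, hk, hr⟩ k'
    exact (hk k').trans_lt ((zero_lt_maxSecrecyRate_iff hs hl (he k)).1 hr)
  · intro h
    obtain ⟨k, hk⟩ := hmax
    exact ⟨huv, k, hk, (zero_lt_maxSecrecyRate_iff hs hl (he k)).2 (h k)⟩

/-! ### Edge probabilities and degrees of the typical node. -/

section Degrees

variable {Ω : Type*} [MeasurableSpace Ω] {μ : Measure Ω} [IsProbabilityMeasure μ]
  {lamL lamE : ℝ≥0} {P s : ℝ} {ν : Measure ℝ} [IsProbabilityMeasure ν] {g : ℝ → ℝ → ℝ}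
  {X Y : ℕ → Ω → Plane} {Z : Sym2 (Option ℕ ⊕ ℕ) → Ω → ℝ}

/-- The position of the node `u` when the legitimate nodes have the positions `w.1`. -/
def nodePosition (u : Option ℕ) (w : (ℕ → Plane) × (ℕ → ℝ)) : Plane := u.elim 0 w.1

lemma measurable_nodePosition (u : Option ℕ) : Measurable (nodePosition u) := by
  cases u with
  | none => exact measurable_const
  | some i => exact (measurable_pi_apply i).comp measurable_fst

lemma withOrigin_eq_nodePosition {Ω : Type*} {X : ℕ → Ω → Plane}
    {Z : Sym2 (Option ℕ ⊕ ℕ) → Ω → ℝ} (ω : Ω) (u : Option ℕ) :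
    withOrigin X ω u = nodePosition u (legitMarked X Z ω) := by
  cases u <;> rfl

lemma measurable_markedPower_nodePosition (hg_meas : Measurable (Function.uncurry g))
    (u : Option ℕ) (k : ℕ) :
    Measurable fun p : ((ℕ → Plane) × (ℕ → ℝ)) × ((ℕ → Plane) × (ℕ → ℝ)) =>
      markedPower P g (nodePosition u p.1) k p.2 :=
  measurable_rxPower P hg_meas ((measurable_nodePosition u).comp measurable_fst)
    ((measurable_pi_apply k).comp (measurable_fst.comp measurable_snd))
    ((measurable_pi_apply k).comp (measurable_snd.comp measurable_snd))

lemma IsPoissonProcess.ae_markedPower_pos {lam : ℝ≥0} (h : IsPoissonProcess lam X μ)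
    (hg_meas : Measurable (Function.uncurry g)) (hP : 0 < P)
    (hg : ∀ᵐ z ∂ν, IsPathGain fun r => g r z) (x : Plane) :
    ∀ᵐ w ∂(markedLaw X μ ν), ∀ i, 0 < markedPower P g x i w := by
  have := h.isProbabilityMeasure_markedLaw (ν := ν)
  have h0 := (h.hasPoissonLaplace_markedPower (P := P) (ν := ν) hg_meas x).ae_forall_notMem
    (measurable_markedPower hg_meas x) (measurableSet_Iic (a := (0 : ℝ)))
    (by simp [powerMeasure_Iic_zero hg_meas hP hg])
  filter_upwards [h0] with w hw i
  exact not_le.1 (hw i)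

lemma IsPoissonNetwork.hasMaxTail (hnet : IsPoissonNetwork lamL lamE ν X Y Z μ)
    (hg_meas : Measurable (Function.uncurry g)) (hP : 0 < P)
    (hg : ∀ᵐ z ∂ν, IsPathGain fun r => g r z)
    (hmax : ∀ᵐ ω ∂μ, ∃ k, IsStrongestEve P g (withOrigin X ω) (fun k => Y k ω) (fun l => Z l ω)
      none k) : HasMaxTail (lamE • powerMeasure P g ν) := by
  have h := hnet.eve_poisson.hasPoissonLaplace_markedPower (P := P) (ν := ν) hg_meas 0
  have hm := hnet.measurable_eveMarked none
  have hlaw : markedLaw Y μ ν = μ.map (eveMarked Y Z none) := (hnet.map_eveMarked none).symm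
  rw [hlaw, hasPoissonLaplace_map_iff hm (measurable_markedPower hg_meas 0)] at h
  exact h.hasMaxTail (fun i => (measurable_markedPower hg_meas 0 i).comp hm)
    (fun t => by simp [powerMeasure_singleton hg_meas hP hg t]) hmax

lemma smul_powerMeasure_Ioi_zero {lam : ℝ≥0} (hlam : 0 < lam)
    (hg_meas : Measurable (Function.uncurry g)) (hP : 0 < P)
    (hg : ∀ᵐ z ∂ν, IsPathGain fun r => g r z) : (lam • powerMeasure P g ν) (Ioi 0) = ∞ := by
  rw [Measure.smul_apply, powerMeasure_Ioi_zero hg_meas hP hg, ENNReal.smul_def, smul_eq_mul,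
    ENNReal.mul_top (by simpa using hlam.ne')]

lemma IsPoissonNetwork.ae_eve_max (hnet : IsPoissonNetwork lamL lamE ν X Y Z μ)
    (hlamE : 0 < lamE) (hg_meas : Measurable (Function.uncurry g)) (hP : 0 < P)
    (hg : ∀ᵐ z ∂ν, IsPathGain fun r => g r z) (hη : HasMaxTail (lamE • powerMeasure P g ν))
    (u : Option ℕ) :
    ∀ᵐ ω ∂μ, (∀ k, 0 < markedPower P g (withOrigin X ω u) k (eveMarked Y Z u ω)) ∧
      ∃ k, ∀ k', markedPower P g (withOrigin X ω u) k' (eveMarked Y Z u ω)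
        ≤ markedPower P g (withOrigin X ω u) k (eveMarked Y Z u ω) := by
  have := hnet.legit_poisson.isProbabilityMeasure_markedLaw (ν := ν)
  have := hnet.eve_poisson.isProbabilityMeasure_markedLaw (ν := ν)
  have hm := measurable_markedPower_nodePosition (P := P) hg_meas u
  let S : Set (((ℕ → Plane) × (ℕ → ℝ)) × ((ℕ → Plane) × (ℕ → ℝ))) :=
    {p | (∀ k, 0 < markedPower P g (nodePosition u p.1) k p.2) ∧
      ∃ k, ∀ k', markedPower P g (nodePosition u p.1) k' p.2
        ≤ markedPower P g (nodePosition u p.1) k p.2}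
  have hS : MeasurableSet S := by
    simp only [S, ofPred_and, ofPred_forall, ofPred_exists]
    exact (MeasurableSet.iInter fun k => measurableSet_lt measurable_const (hm k)).inter
      (MeasurableSet.iUnion fun k => MeasurableSet.iInter fun k' =>
        measurableSet_le (hm k') (hm k))
  -- By Fubini the legitimate configuration, and with it the position of `u`, may be held fixed.
  have hae : ∀ᵐ p ∂((markedLaw X μ ν).prod (markedLaw Y μ ν)), p ∈ S := by
    refine (Measure.ae_prod_mem_iff_ae_ae_mem hS).2 (ae_of_all _ fun w => ?_)
    filter_upwards [hnet.eve_poisson.ae_markedPower_pos hg_meas hP hg (nodePosition u w),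
      hη.ae_exists_max (smul_powerMeasure_Ioi_zero hlamE hg_meas hP hg)
        (hnet.eve_poisson.hasPoissonLaplace_markedPower hg_meas (nodePosition u w))
        (measurable_markedPower hg_meas (nodePosition u w))] with w' h1 h2
    exact ⟨h1, h2⟩
  rw [← hnet.map_legitMarked_eveMarked u] at hae
  have hT : Measurable fun ω => (legitMarked X Z ω, eveMarked Y Z u ω) :=
    hnet.measurable_legitMarked.prodMk (hnet.measurable_eveMarked u)
  filter_upwards [ae_of_ae_map hT.aemeasurable hae] with ω hω
  rw [withOrigin_eq_nodePosition (Z := Z)]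
  exact hω

/-- Conditioning on the legitimate configuration leaves a void probability. The point is that the
right-hand side does not involve `u`. -/
lemma IsPoissonNetwork.measure_forall_eve_lt (hnet : IsPoissonNetwork lamL lamE ν X Y Z μ)
    (hg_meas : Measurable (Function.uncurry g)) (u : Option ℕ)
    {t : (ℕ → Plane) × (ℕ → ℝ) → ℝ} (ht : Measurable t) :
    μ {ω | ∀ k, markedPower P g (withOrigin X ω u) k (eveMarked Y Z u ω)
      < t (legitMarked X Z ω)} =
      ∫⁻ w, expNeg ((lamE • powerMeasure P g ν) (Ici (t w))) ∂(markedLaw X μ ν) := by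
  have := hnet.legit_poisson.isProbabilityMeasure_markedLaw (ν := ν)
  have := hnet.eve_poisson.isProbabilityMeasure_markedLaw (ν := ν)
  have hm := measurable_markedPower_nodePosition (P := P) hg_meas u
  have hms : MeasurableSet {p : ((ℕ → Plane) × (ℕ → ℝ)) × ((ℕ → Plane) × (ℕ → ℝ)) |
      ∀ k, markedPower P g (nodePosition u p.1) k p.2 < t p.1} := by
    simp only [ofPred_forall]
    exact MeasurableSet.iInter fun k => measurableSet_lt (hm k) (ht.comp measurable_fst)
  simp only [withOrigin_eq_nodePosition (Z := Z)]
  have h1 := Measure.map_apply (μ := μ) (hnet.measurable_legitMarked.prodMk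
    (hnet.measurable_eveMarked u)) hms
  refine h1.symm.trans ?_
  rw [hnet.map_legitMarked_eveMarked u, Measure.prod_apply hms]
  refine lintegral_congr fun w => ?_
  have h2 := (hnet.eve_poisson.hasPoissonLaplace_markedPower (P := P) (ν := ν) hg_meas
    (nodePosition u w)).measure_forall_notMem (measurable_markedPower hg_meas _)
    (measurableSet_Ici (a := t w))
  rw [← h2]
  simp only [mem_Ici, not_le]
  rfl

/-- The edges between the typical node and the `i`-th legitimate node, described by the received
powers. -/
lemma IsPoissonNetwork.ae_adj_iff (hnet : IsPoissonNetwork lamL lamE ν X Y Z μ)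
    (hlamE : 0 < lamE) (hg_meas : Measurable (Function.uncurry g)) (hP : 0 < P) (hs : 0 < s)
    (hg : ∀ᵐ z ∂ν, IsPathGain fun r => g r z) (hη : HasMaxTail (lamE • powerMeasure P g ν)) :
    ∀ᵐ ω ∂μ, ∀ i,
      ((poissonISGraph P s g X Y Z ω).Adj none (some i) ↔
        ∀ k, markedPower P g (withOrigin X ω none) k (eveMarked Y Z none ω)
          < markedPower P g 0 i (legitMarked X Z ω)) ∧
      ((poissonISGraph P s g X Y Z ω).Adj (some i) none ↔
        ∀ k, markedPower P g (withOrigin X ω (some i)) k (eveMarked Y Z (some i) ω)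
          < markedPower P g 0 i (legitMarked X Z ω)) := by
  have hL := hnet.legit_poisson.ae_markedPower_pos (ν := ν) hg_meas hP hg 0
  rw [← hnet.map_legitMarked] at hL
  have hL' := ae_of_ae_map hnet.measurable_legitMarked.aemeasurable hL
  have hE := ae_all_iff.2 fun u => hnet.ae_eve_max hlamE hg_meas hP hg hη u
  filter_upwards [hL', hE] with ω hω hωE i
  have hsymm : rxPower P g (withOrigin X ω (some i)) (withOrigin X ω none)
      (Z s(Sum.inl (some i), Sum.inl none) ω) = markedPower P g 0 i (legitMarked X Z ω) := by
    rw [Sym2.eq_swap, rxPower, dist_comm]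
    rfl
  constructor
  · exact poissonISGraph_adj_iff hs (by simp) (hω i) (hωE none).1 (hωE none).2
  · have := poissonISGraph_adj_iff (Z := Z) hs (u := some i) (v := none) (by simp)
      (by rw [hsymm]; exact hω i) (hωE (some i)).1 (hωE (some i)).2
    rwa [hsymm] at this

lemma IsPoissonNetwork.measure_adj_comm (hnet : IsPoissonNetwork lamL lamE ν X Y Z μ)
    (hlamE : 0 < lamE) (hg_meas : Measurable (Function.uncurry g)) (hP : 0 < P) (hs : 0 < s)
    (hg : ∀ᵐ z ∂ν, IsPathGain fun r => g r z) (hη : HasMaxTail (lamE • powerMeasure P g ν))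
    (v : Option ℕ) :
    μ {ω | (poissonISGraph P s g X Y Z ω).Adj v none} =
      μ {ω | (poissonISGraph P s g X Y Z ω).Adj none v} := by
  cases v with
  | none => rfl
  | some i =>
    have hadj := hnet.ae_adj_iff hlamE hg_meas hP hs hg hη
    have ht := measurable_markedPower (P := P) hg_meas 0 i
    -- Both directions compare the same link power with the eavesdroppers, seen from the origin or
    -- from node `i`.
    have h1 := measure_congr (hadj.mono fun ω h => propext (h i).1)
    have h2 := measure_congr (hadj.mono fun ω h => propext (h i).2)
    exact (h2.trans (hnet.measure_forall_eve_lt hg_meas _ ht)).trans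
      (h1.trans (hnet.measure_forall_eve_lt hg_meas _ ht)).symm

lemma IsPoissonNetwork.lintegral_enatPow_outDegree (hnet : IsPoissonNetwork lamL lamE ν X Y Z μ)
    (hlamE : 0 < lamE) (hg_meas : Measurable (Function.uncurry g)) (hP : 0 < P) (hs : 0 < s)
    (hg : ∀ᵐ z ∂ν, IsPathGain fun r => g r z) (hη : HasMaxTail (lamE • powerMeasure P g ν))
    {c : ℝ≥0} (hc : c ≤ 1) :
    ∫⁻ ω, enatPow c (outDegree (poissonISGraph P s g X Y Z ω) none) ∂μ =
      (1 + (lamL / lamE * (1 - c) : ℝ≥0) : ℝ≥0∞)⁻¹ := by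
  have := hnet.legit_poisson.isProbabilityMeasure_markedLaw (ν := ν)
  have := hnet.eve_poisson.isProbabilityMeasure_markedLaw (ν := ν)
  have hU := hnet.legit_poisson.hasPoissonLaplace_markedPower (P := P) (ν := ν) hg_meas 0
  -- The legitimate intensity is written as `lamL / lamE` times the eavesdropper intensity.
  rw [← div_mul_cancel₀ lamL hlamE.ne', mul_smul] at hU
  rw [← lintegral_enatPow_count_above hη (smul_powerMeasure_Ioi_zero hlamE hg_meas hP hg)
    (fun t => by simp [powerMeasure_singleton hg_meas hP hg t])
    (measurable_markedPower hg_meas 0)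
    (hnet.eve_poisson.hasPoissonLaplace_markedPower (P := P) (ν := ν) hg_meas 0)
    (measurable_markedPower hg_meas 0) hU hc]
  have hmeas : ∀ i, MeasurableSet {p : ((ℕ → Plane) × (ℕ → ℝ)) × ((ℕ → Plane) × (ℕ → ℝ)) |
      ∀ k, markedPower P g 0 k p.1 < markedPower P g 0 i p.2} := fun i => by
    simp only [ofPred_forall]
    exact MeasurableSet.iInter fun k =>
      measurableSet_lt ((measurable_markedPower hg_meas 0 k).comp measurable_fst)
        ((measurable_markedPower hg_meas 0 i).comp measurable_snd)
  rw [← Measure.prod_swap, ← hnet.map_legitMarked_eveMarked none,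
    Measure.map_map measurable_swap (hnet.measurable_legitMarked.prodMk
      (hnet.measurable_eveMarked none)),
    lintegral_map (f := fun p : ((ℕ → Plane) × (ℕ → ℝ)) × ((ℕ → Plane) × (ℕ → ℝ)) =>
      enatPow c {i | ∀ k, markedPower P g 0 k p.1 < markedPower P g 0 i p.2}.encard)
      ((measurable_from_top (f := enatPow c)).comp (measurable_setOf_encard hmeas))
      (measurable_swap.comp (hnet.measurable_legitMarked.prodMk
      (hnet.measurable_eveMarked none)))]
  refine lintegral_congr_ae ?_
  filter_upwards [hnet.ae_adj_iff hlamE hg_meas hP hs hg hη] with ω hω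
  have hset : {w | (poissonISGraph P s g X Y Z ω).Adj none w} =
      some '' {i | ∀ k, markedPower P g 0 k (eveMarked Y Z none ω)
        < markedPower P g 0 i (legitMarked X Z ω)} := by
    ext w
    cases w with
    | none => simpa using fun h => h.1 rfl
    | some i =>
      have h := (hω i).1
      rw [show withOrigin X ω none = 0 from rfl] at h
      simpa using h
  rw [outDegree, hset, (Option.some_injective ℕ).encard_image]
  rfl

end Degrees

end SecrecyGraph

open SecrecyGraph

theorem mainTheorem4 {Ω : Type*} [MeasurableSpace Ω] (μ : Measure Ω) [IsProbabilityMeasure μ]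
    (lamL lamE : ℝ≥0) (hlamL : 0 < lamL) (hlamE : 0 < lamE)
    (P s : ℝ) (hP : 0 < P) (hs : 0 < s)
    (ν : Measure ℝ) [IsProbabilityMeasure ν]
    (g : ℝ → ℝ → ℝ) (hg_meas : Measurable (Function.uncurry g))
    (hg : ∀ᵐ z ∂ν, SecrecyGraph.IsPathGain (fun r => g r z))
    (X Y : ℕ → Ω → SecrecyGraph.Plane) (Z : Sym2 (Option ℕ ⊕ ℕ) → Ω → ℝ)
    (hnet : SecrecyGraph.IsPoissonNetwork lamL lamE ν X Y Z μ)
    (hmax : ∀ᵐ ω ∂μ, ∃ k : ℕ, SecrecyGraph.IsStrongestEve P g (SecrecyGraph.withOrigin X ω)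
      (fun k => Y k ω) (fun l => Z l ω) none k) :
    Measurable (fun ω => SecrecyGraph.outDegree (SecrecyGraph.poissonISGraph P s g X Y Z ω) none) ∧
    Measurable (fun ω => SecrecyGraph.inDegree (SecrecyGraph.poissonISGraph P s g X Y Z ω) none) ∧
    (∀ n : ℕ,
      μ.real {ω | SecrecyGraph.outDegree (SecrecyGraph.poissonISGraph P s g X Y Z ω) none = n} =
        ((lamL : ℝ) / (lamL + lamE)) ^ n * ((lamE : ℝ) / (lamL + lamE))) ∧
    ∫⁻ ω, (SecrecyGraph.inDegree (SecrecyGraph.poissonISGraph P s g X Y Z ω) none : ℝ≥0∞) ∂μ =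
      (lamL : ℝ≥0∞) / lamE ∧
    ∫⁻ ω, (SecrecyGraph.outDegree (SecrecyGraph.poissonISGraph P s g X Y Z ω) none : ℝ≥0∞) ∂μ =
      (lamL : ℝ≥0∞) / lamE := by
  have hη := hnet.hasMaxTail hg_meas hP hg hmax
  have hadj := hnet.measurableSet_adj (P := P) (s := s) hg_meas
  have hout : Measurable fun ω => outDegree (poissonISGraph P s g X Y Z ω) none :=
    measurable_setOf_encard fun w => hadj none w
  have hin : Measurable fun ω => inDegree (poissonISGraph P s g X Y Z ω) none :=
    measurable_setOf_encard fun w => hadj w none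
  have hgeom := measureReal_eq_geometric hout (lamL / lamE) fun c hc =>
    hnet.lintegral_enatPow_outDegree hlamE hg_meas hP hs hg hη hc.le
  have hmean := lintegral_of_geometric hout (lamL / lamE) hgeom
  rw [ENNReal.coe_div hlamE.ne'] at hmean
  refine ⟨hout, hin, fun n => ?_, ?_, hmean⟩
  · rw [hgeom n, NNReal.coe_div]
    have hE : (0 : ℝ) < lamE := hlamE
    have hL : (0 : ℝ) < lamL := hlamL
    have h1 : (lamL : ℝ) / lamE / (1 + lamL / lamE) = lamL / (lamL + lamE) := by
      field_simp
      ring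
    have h2 : 1 / (1 + (lamL : ℝ) / lamE) = lamE / (lamL + lamE) := by
      field_simp
      ring
    rw [h1, h2]
  -- Each mean degree is the sum over nodes of edge probabilities, which agree term by term.
  · rw [← hmean]
    refine (lintegral_encard fun w => hadj w none).trans
      (Eq.trans (tsum_congr fun w => ?_) (lintegral_encard fun w => hadj none w).symm)
    exact hnet.measure_adj_comm hlamE hg_meas hP hs hg hη w
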